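/- **Setting.** Let $\mathcal X$ be a measurable space, $K,d\in\mathbb N$, and let $O=(X,A,Y)\in\mathcal X\times[K]\times[0,1]^{d}$ have law $P=P_X\times P_{A|X}\times P_{Y|A,X}$. Put $e(k,x)=P(A=k\mid X=x)$ and $\mu_j(k,x)=\mathbb E_P[Y_j\mid A=k,X=x]$; the propensity $e$ is known, and $e(k,x)\ge c$ for all $k$ and ($P_X$-almost) all $x$, for some constant $c\in(0,1)$. A policy $\pi$ is a (measurable) map from $\mathcal X$ to distributions on $[K]$, $\pi(k,x)$ is the probability of treatment $k$ at $x$, and $V_j(\pi)=\mathbb E_{P_X}\big[\sum_{k}\pi(k,X)\mu_j(k,X)\big]$. Fix a baseline policy $\pi_0$, a finite family $\widetilde\Pi=\{\pi_1,\dots,\pi_T\}$ of policies, a set $\mathcal S\subseteq[d]$ of guardrail outcomes, weights $w\in\mathbb R^{\mathcal S}$ and $\alpha\in(0,1)$. **Lower bounds.** Observe i.i.d. $O_1,\dots,O_n\sim P$. Split the indices into a fixed number $F$ of folds, possibly at random but independently of the data; $f(i)$ denotes the fold of $i$. For each fold $l$ let $\hat\mu^{l}$ be an estimate of $\mu$ computed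 from the observations outside fold $l$ only (and, possibly, auxiliary randomness independent of the data). Put $$\psi_{jk}(O;m,e)=\frac{\mathbf 1[A=k]\,(Y_j-m_j(k,X))}{e(k,X)}+m_j(k,X),\qquad \psi_j(O,\pi;m,e)=\sum_{k}\pi(k,X)\,\psi_{jk}(O;m,e),$$ $$\hat V_j(\pi)=\frac1n\sum_{i=1}^n\psi_j(O_i,\pi;\hat\mu^{f(i)},e),\qquad \hat D_j(\pi)=\hat V_j(\pi)-(1+w_j)\hat V_j(\pi_0),$$ $$\hat d_j(O_i,\pi)=\psi_j(O_i,\pi;\hat\mu^{f(i)},e)-(1+w_j)\,\psi_j(O_i,\pi_0;\hat\mu^{f(i)},e),$$ and let $\widehat\Sigma$ be the matrix indexed by $[T]\times\mathcal S$ with entries $$\widehat\Sigma_{(p_1,s_1),(p_2,s_2)}=\frac1n\sum_{i=1}^n\big(\hat d_{s_1}(O_i,\pi_{p_1})-\hat D_{s_1}(\pi_{p_1})\big)\big(\hat d_{s_2}(O_i,\pi_{p_2})-\hat D_{s_2}(\pi_{p_2})\big).$$ Let $\tilde\rho^{(1)},\dots,\tilde\rho^{(n_{\rm sim})}$ be,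 given the data and the auxiliary randomness, i.i.d. $N(0,\widehat\Sigma)$ vectors, and let $z^*_{n_{\rm sim}}(\alpha)$ be the lower empirical $\alpha$-quantile $\inf\{x:\#\{s: M_s\le x\}\ge\alpha n_{\rm sim}\}$ of the $n_{\rm sim}$ numbers $M_s=\min_{a\in[T]\times\mathcal S}\widehat\Sigma_{aa}^{-1/2}\tilde\rho^{(s)}_a$, where a coordinate with $\widehat\Sigma_{aa}=0$ contributes $0$. The lower bounds are $$\hat C_j(\pi_t,\alpha)=\hat D_j(\pi_t)+\frac{z^*_{n_{\rm sim}}(\alpha)}{\sqrt n}\,\widehat\Sigma_{(t,j),(t,j)}^{1/2},\qquad t\in[T],\ j\in\mathcal S .$$ **Lemma (asymptotic validity).** Assume that (i) for all $n$ and all folds $l$, almost surely the functions $\hat\mu^{l}_j$, $j\in\mathcal S$, are $P$-essentially bounded; (ii) $\|\hat\mu^{l}_j(A,X)-\mu_j(A,X)\|_{P,2}=o_P(1)$ as $n\to\infty$, for every fold $l$ and every $j\in\mathcal S$; (iii) there is $v>0$ with $\mathrm{Var}(Y_j\mid A=a,X=x)\ge v$ for all $a\in[K]$, $j\in\mathcal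 S$ and $P_X$-almost all $x$. Then for every $n$ the inner limit below exists, and $$\limsup_{n\to\infty}\ \lim_{n_{\rm sim}\to\infty}\ \Pr\Big(\exists\,\pi\in\widetilde\Pi,\ j\in\mathcal S:\ V_j(\pi)-(1+w_j)V_j(\pi_0)<\hat C_j(\pi,\alpha)\Big)\le\alpha ,$$ where $\Pr$ is over the data, the auxiliary randomness and the simulated vectors. -/

import Mathlib

open MeasureTheory ProbabilityTheory Filter Topology
open scoped ENNReal

noncomputable section

namespace SafePolicy

/-- An observation `O = (X, A, Y)`, written `((X, A), Y)`: a covariate in `𝒳`, a treatment among `K`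
treatments and an outcome vector in `[0,1]^d`. -/
abbrev Obs (𝒳 : Type*) (K d : ℕ) := (𝒳 × Fin K) × (Fin d → unitInterval)

/-- The distribution `P = P_X × P_{A|X} × P_{Y|A,X}` of one observation, through its factors. -/
structure DataModel (𝒳 : Type*) [MeasurableSpace 𝒳] (K d : ℕ) where
  /-- `P_X` -/
  covariateLaw : Measure 𝒳
  /-- `P_{A|X}` -/
  treatmentLaw : Kernel 𝒳 (Fin K)
  /-- `P_{Y|A,X}` -/
  outcomeLaw : Kernel (𝒳 × Fin K) (Fin d → unitInterval)
  isProb_covariateLaw : IsProbabilityMeasure covariateLaw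
  isMarkov_treatmentLaw : IsMarkovKernel treatmentLaw
  isMarkov_outcomeLaw : IsMarkovKernel outcomeLaw

attribute [instance] DataModel.isProb_covariateLaw DataModel.isMarkov_treatmentLaw
  DataModel.isMarkov_outcomeLaw

namespace DataModel

variable {𝒳 : Type*} [MeasurableSpace 𝒳] {K d : ℕ} (M : DataModel 𝒳 K d)

/-- The joint law of `(X, A)`. -/
def designLaw : Measure (𝒳 × Fin K) := M.covariateLaw ⊗ₘ M.treatmentLaw

/-- The law `P` of `O = (X, A, Y)`. -/
def obsLaw : Measure (Obs 𝒳 K d) := M.designLaw ⊗ₘ M.outcomeLaw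

/-- The propensity score `e(k, x) = P(A = k | X = x)`. -/
def propensity (k : Fin K) (x : 𝒳) : ℝ := (M.treatmentLaw x).real {k}

/-- The outcome regression `μ_j(k, x) = E[Y_j | A = k, X = x]`. -/
def outcomeMean (j : Fin d) (k : Fin K) (x : 𝒳) : ℝ := ∫ y, (y j : ℝ) ∂(M.outcomeLaw (x, k))

/-- The conditional variance `Var(Y_j | A = k, X = x)`. -/
def outcomeVar (j : Fin d) (k : Fin K) (x : 𝒳) : ℝ :=
  variance (fun y : Fin d → unitInterval => (y j : ℝ)) (M.outcomeLaw (x, k))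

/-- The policy value `V_j(π) = E_{P_X}[∑_k π(k, X) μ_j(k, X)]`. A policy is a Markov kernel from
covariates to treatments, and `π(k, x)` is `(π x).real {k}`. -/
def policyValue (π : Kernel 𝒳 (Fin K)) (j : Fin d) : ℝ :=
  ∫ x, ∑ k, (π x).real {k} * M.outcomeMean j k x ∂M.covariateLaw

/-- The doubly robust score `ψ_{jk}(O; m, e) = 1[A = k] (Y_j - m_j(k, X)) / e(k, X) + m_j(k, X)`. -/
def drScore (m : Fin d → Fin K → 𝒳 → ℝ) (j : Fin d) (k : Fin K) (o : Obs 𝒳 K d) : ℝ :=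
  (if o.1.2 = k then (1 : ℝ) else 0) * ((o.2 j : ℝ) - m j k o.1.1) / M.propensity k o.1.1
    + m j k o.1.1

/-- The policy score `ψ_j(O, π; m, e) = ∑_k π(k, X) ψ_{jk}(O; m, e)`. -/
def policyScore (m : Fin d → Fin K → 𝒳 → ℝ) (π : Kernel 𝒳 (Fin K)) (j : Fin d)
    (o : Obs 𝒳 K d) : ℝ :=
  ∑ k, (π o.1.1).real {k} * M.drScore m j k o

end DataModel

/-- A cross-fitting scheme with `F` folds. For sample size `n`, a random element of `𝒰` with law
`seedLaw n`, independent of the data, carries all auxiliary randomness: it determines the random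
split into folds, and the learning algorithms may use it too. `learner n l T D u` is the outcome
regression which the algorithm for fold `l` returns from the observations `D` with indices in the
training set `T`. -/
structure CrossFit (𝒳 : Type*) [MeasurableSpace 𝒳] (K d F : ℕ) (𝒰 : Type*)
    [MeasurableSpace 𝒰] where
  seedLaw : ℕ → Measure 𝒰
  fold : (n : ℕ) → 𝒰 → Fin n → Fin F
  learner : (n : ℕ) → Fin F → (T : Finset (Fin n)) → (T → Obs 𝒳 K d) → 𝒰 →
    Fin d → Fin K → 𝒳 → ℝ
  isProb_seedLaw : ∀ n, IsProbabilityMeasure (seedLaw n)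
  measurable_fold : ∀ n, Measurable (fold n)
  measurable_learner : ∀ (n : ℕ) (l : Fin F) (T : Finset (Fin n)) (j : Fin d) (k : Fin K),
    Measurable fun p : ((T → Obs 𝒳 K d) × 𝒰) × 𝒳 => learner n l T p.1.1 p.1.2 j k p.2

attribute [instance] CrossFit.isProb_seedLaw

/-- The lower empirical `α`-quantile `inf {x | #{s | v_s ≤ x} / m ≥ α}` of `v_1, …, v_m`. -/
def empiricalQuantile {m : ℕ} (α : ℝ) (v : Fin m → ℝ) : ℝ :=
  sInf {x : ℝ | α ≤ (Nat.card {s : Fin m // v s ≤ x} : ℝ) / m}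

namespace CrossFit

variable {𝒳 : Type*} [MeasurableSpace 𝒳] {K d F : ℕ} {𝒰 : Type*} [MeasurableSpace 𝒰]
  (C : CrossFit 𝒳 K d F 𝒰) (M : DataModel 𝒳 K d)

/-- The joint law of `n` i.i.d. observations and the independent auxiliary randomness. -/
def sampleLaw (n : ℕ) : Measure ((Fin n → Obs 𝒳 K d) × 𝒰) :=
  (Measure.pi fun _ : Fin n => M.obsLaw).prod (C.seedLaw n)

variable {n : ℕ}

/-- `μ̂^l`, trained on all folds except the `l`-th. -/
def muHat (ω : (Fin n → Obs 𝒳 K d) × 𝒰) (l : Fin F) : Fin d → Fin K → 𝒳 → ℝ :=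
  C.learner n l {i | C.fold n ω.2 i ≠ l} (fun i => ω.1 i) ω.2

/-- `ψ_j(O_i, π; μ̂^{f(i)}, e)`. -/
def fittedScore (ω : (Fin n → Obs 𝒳 K d) × 𝒰) (π : Kernel 𝒳 (Fin K)) (j : Fin d)
    (i : Fin n) : ℝ :=
  M.policyScore (C.muHat ω (C.fold n ω.2 i)) π j (ω.1 i)

/-- `V̂_j(π)`, the cross-fitted doubly robust estimate of the policy value. -/
def valueHat (ω : (Fin n → Obs 𝒳 K d) × 𝒰) (π : Kernel 𝒳 (Fin K)) (j : Fin d) : ℝ :=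
  (∑ i, C.fittedScore M ω π j i) / n

variable {S : Finset (Fin d)} {T : ℕ} (w : S → ℝ) (π₀ : Kernel 𝒳 (Fin K))
  (pol : Fin T → Kernel 𝒳 (Fin K))

/-- `D̂_j(π) = V̂_j(π) - (1 + w_j) V̂_j(π₀)`. -/
def diffHat (ω : (Fin n → Obs 𝒳 K d) × 𝒰) (π : Kernel 𝒳 (Fin K)) (j : S) : ℝ :=
  C.valueHat M ω π j - (1 + w j) * C.valueHat M ω π₀ j

/-- `d̂_j(O_i, π) = ψ_j(O_i, π; μ̂^{f(i)}, e) - (1 + w_j) ψ_j(O_i, π₀; μ̂^{f(i)}, e)`. -/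
def diffScore (ω : (Fin n → Obs 𝒳 K d) × 𝒰) (π : Kernel 𝒳 (Fin K)) (j : S) (i : Fin n) : ℝ :=
  C.fittedScore M ω π j i - (1 + w j) * C.fittedScore M ω π₀ j i

/-- The empirical covariance matrix `Σ̂`, indexed by pairs of a policy and a guardrail outcome. -/
def covHat (ω : (Fin n → Obs 𝒳 K d) × 𝒰) : Matrix (Fin T × S) (Fin T × S) ℝ :=
  fun a b => (∑ i,
    (C.diffScore M w π₀ ω (pol a.1) a.2 i - C.diffHat M w π₀ ω (pol a.1) a.2) *
      (C.diffScore M w π₀ ω (pol b.1) b.2 i - C.diffHat M w π₀ ω (pol b.1) b.2)) / n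

/-- The simulated sup-t critical value: the lower `α`-quantile, over the simulated vectors
`ρ_1, …, ρ_m`, of the minimum of the coordinates of `ρ_s` divided by their standard errors
(a coordinate with zero standard error contributes `0`). -/
def critValue (α : ℝ) (ω : (Fin n → Obs 𝒳 K d) × 𝒰) {m : ℕ}
    (ρ : Fin m → EuclideanSpace ℝ (Fin T × S)) : ℝ :=
  empiricalQuantile α fun s => ⨅ a, ρ s a / √(C.covHat M w π₀ pol ω a a)

/-- The lower confidence bound for outcome `j` and the `t`-th policy. The critical value is a lower
quantile, hence typically negative, so that it enters with a plus sign. -/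
def lowerBound (α : ℝ) (ω : (Fin n → Obs 𝒳 K d) × 𝒰) {m : ℕ}
    (ρ : Fin m → EuclideanSpace ℝ (Fin T × S)) (t : Fin T) (j : S) : ℝ :=
  C.diffHat M w π₀ ω (pol t) j +
    C.critValue M w π₀ pol α ω ρ / √n * √(C.covHat M w π₀ pol ω (t, j) (t, j))

/-- The probability, over the data, the auxiliary randomness and `m` simulated vectors that are
i.i.d. `N(0, Σ̂)` given these, that at least one lower bound exceeds its target. -/
def missProb (α : ℝ) (n m : ℕ) : ℝ≥0∞ :=
  ∫⁻ ω, (Measure.pi fun _ : Fin m => multivariateGaussian 0 (C.covHat M w π₀ pol ω))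
    {ρ | ∃ (t : Fin T) (j : S),
      M.policyValue (pol t) j - (1 + w j) * M.policyValue π₀ j < C.lowerBound M w π₀ pol α ω ρ t j}
    ∂(C.sampleLaw M n)

end CrossFit

end SafePolicy

end

noncomputable section

namespace SafePolicy

/-! ### The empirical quantile -/

/-! Fix the data. A bound with positive estimated standard error misses its target exactly when the
simulated critical value exceeds the studentized error `√n (target - D̂) / σ̂`; hence some such
bound misses iff the critical value exceeds the smallest studentized error. By the law of large
numbers for the simulated minima, the probability of this tends to `0` as `m → ∞` unless the
Gaussian law with covariance `Σ̂` gives the event "minimum at most the studentized error" mass at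
most `α`. The limit exists also in the case of equality, by the central limit theorem, and is then
simply bounded by `1`. Dominated convergence passes the limit through the data
(`exists_tendsto_pi_missSet`, `measurable_pi_missSet`). It remains to bound the probability, over
the data, that some studentized error lies in this lower tail.

Since the propensity is known, replacing `μ` by a fixed regression changes each score by a centred
term whose second moment is controlled by the `L²` error of the regression. Cross-fitting makes the
regression fixed conditionally on the seed and the training data. Chebyshev and Markov bounds on
each fold then show that the estimated errors behave as if `μ` were known (`vanishes_sum_diffRem`,
`vanishes_sum_diffRem_sq`), so that `√n (target - D̂)` is asymptotically `N(0, Σ)` and `Σ̂ → Σ` in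
probability.

The tail event says that the pair (scaled error, `Σ̂`) lies in `rejectSet`. Slutsky and the
portmanteau theorem bound the limsup of its probability by the mass of the closure at `Σ`; on the
coordinates with positive limiting variance the closure adds nothing at `Σ`
(`mem_rejectSet_of_mem_closure`). For the Gaussian limit itself the bound `α` is the probability
integral transform of the minimum (`multivariateGaussian_rejectSet_le`).

A coordinate with zero limiting variance compares a policy with an identical baseline at weight `0`,
because the outcome has positive conditional variance. Its error and estimated variance vanish
almost surely, so it never misses (`ae_degenerate`). -/

lemma natCard_le_mono {m : ℕ} (v : Fin m → ℝ) {x y : ℝ} (h : x ≤ y) :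
    Nat.card {s : Fin m // v s ≤ x} ≤ Nat.card {s : Fin m // v s ≤ y} :=
  Nat.card_mono (s := {s | v s ≤ x}) (t := {s | v s ≤ y}) (Set.toFinite _)
    fun _ hs => le_trans hs h

/-- The condition says that some large enough set of indices has all its values below `x`: a finite
union of finite intersections of closed rays. Closedness makes the infimum defining the quantile
attained. -/
lemma isClosed_setOf_le_natCard {m : ℕ} (v : Fin m → ℝ) (b : ℝ) :
    IsClosed {x : ℝ | b ≤ (Nat.card {s : Fin m // v s ≤ x} : ℝ) / m} := by
  classical
  have : {x : ℝ | b ≤ (Nat.card {s : Fin m // v s ≤ x} : ℝ) / m} =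
      ⋃ B ∈ {B : Finset (Fin m) | b ≤ (B.card : ℝ) / m}, ⋂ s ∈ B, Set.Ici (v s) := by
    ext x
    simp only [Set.mem_ofPred_eq, Set.mem_iUnion, Set.mem_iInter, Set.mem_Ici, exists_prop]
    constructor
    · intro h
      refine ⟨Finset.univ.filter fun s => v s ≤ x, ?_, by simp⟩
      rwa [Nat.card_eq_fintype_card, Fintype.card_subtype] at h
    · rintro ⟨B, hB, hx⟩
      refine hB.trans ?_
      rw [Nat.card_eq_fintype_card, Fintype.card_subtype]
      gcongr
      intro s hs
      simpa using hx s hs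
  rw [this]
  exact (Set.toFinite _).isClosed_biUnion fun B _ =>
    isClosed_biInter fun s _ => isClosed_Ici

lemma empiricalQuantile_le_iff {m : ℕ} (hm : 0 < m) {α : ℝ} (hα : α ∈ Set.Ioo (0 : ℝ) 1)
    (v : Fin m → ℝ) (x : ℝ) :
    empiricalQuantile α v ≤ x ↔ α ≤ (Nat.card {s : Fin m // v s ≤ x} : ℝ) / m := by
  have : Nonempty (Fin m) := ⟨⟨0, hm⟩⟩
  set A := {x : ℝ | α ≤ (Nat.card {s : Fin m // v s ≤ x} : ℝ) / m} with hA
  obtain ⟨lo, hlo⟩ := Finite.exists_min v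
  obtain ⟨hi, hhi⟩ := Finite.exists_max v
  -- At the largest value the fraction is `1 ≥ α`; below the smallest value it is `0 < α`.
  have hne : A.Nonempty := by
    refine ⟨v hi, ?_⟩
    have : Nat.card {s : Fin m // v s ≤ v hi} = m := by
      simp [hhi]
    simp only [hA, Set.mem_ofPred_eq, this]
    rw [div_self (by positivity)]
    exact hα.2.le
  have hbdd : BddBelow A := by
    refine ⟨v lo, fun y hy => ?_⟩
    by_contra! h
    have : IsEmpty {s : Fin m // v s ≤ y} := ⟨fun s => by
      have := hlo s.1
      have := s.2
      linarith⟩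
    simp only [hA, Set.mem_ofPred_eq, Nat.card_of_isEmpty] at hy
    simp only [Nat.cast_zero, zero_div] at hy
    exact absurd hα.1 (not_lt.2 hy)
  have hmem : sInf A ∈ A := (isClosed_setOf_le_natCard v α).csInf_mem hne hbdd
  constructor
  · intro h
    refine le_trans hmem ?_
    have := natCard_le_mono v h
    gcongr
    exact this
  · intro h
    exact csInf_le hbdd h

lemma natCard_eq_sum_indicator {m : ℕ} (v : Fin m → ℝ) (x : ℝ) :
    (Nat.card {s : Fin m // v s ≤ x} : ℝ) = ∑ s, (Set.Iic x).indicator (fun _ => (1 : ℝ)) (v s) := by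
  classical
  rw [Nat.card_eq_fintype_card, Fintype.card_subtype]
  simp [Set.indicator_apply, Finset.sum_boole]

lemma measurable_empiricalQuantile {m : ℕ} {α : ℝ} (hα : α ∈ Set.Ioo (0 : ℝ) 1) :
    Measurable fun v : Fin m → ℝ => empiricalQuantile α v := by
  rcases Nat.eq_zero_or_pos m with rfl | hm
  · exact measurable_of_finite _
  · refine measurable_of_Iic fun x => ?_
    have : (fun v : Fin m → ℝ => empiricalQuantile α v) ⁻¹' Set.Iic x =
        {v | α ≤ (∑ s, (Set.Iic x).indicator (fun _ => (1 : ℝ)) (v s)) / m} := by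
      ext v
      simp only [Set.mem_preimage, Set.mem_Iic, Set.mem_ofPred_eq]
      rw [empiricalQuantile_le_iff hm hα, natCard_eq_sum_indicator]
    rw [this]
    refine measurableSet_le measurable_const (Measurable.div_const ?_ _)
    refine Finset.measurable_sum _ fun s _ => ?_
    exact (measurable_const.indicator measurableSet_Iic).comp (measurable_pi_apply s)

/-! ### Sums over a product measure: Chebyshev, weak law of large numbers, central limit theorem -/

section PiSums

variable {O : Type*} [MeasurableSpace O] (P : Measure O) [IsProbabilityMeasure P]

lemma integral_sum_pi {κ : Type*} [Fintype κ] {g : O → ℝ} (hg : Integrable g P) :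
    ∫ o, ∑ i, g (o i) ∂(Measure.pi fun _ : κ => P) = Fintype.card κ * ∫ o, g o ∂P := by
  rw [integral_finsetSum]
  · simp_rw [integral_comp_eval (μ := fun _ : κ => P) hg.aestronglyMeasurable]
    simp
  · intro i _
    exact integrable_comp_eval (μ := fun _ : κ => P) hg

lemma memLp_sum_pi {κ : Type*} [Fintype κ] {g : O → ℝ} (hg : MemLp g 2 P) :
    MemLp (fun o : κ → O => ∑ i, g (o i)) 2 (Measure.pi fun _ : κ => P) :=
  memLp_finsetSum _ fun i _ => hg.comp_measurePreserving (measurePreserving_eval _ i)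

lemma variance_sum_pi_const {κ : Type*} [Fintype κ] {g : O → ℝ} (hg : MemLp g 2 P) :
    Var[fun o : κ → O => ∑ i, g (o i); Measure.pi fun _ : κ => P] =
      Fintype.card κ * Var[g; P] := by
  have := variance_sum_pi (μ := fun _ : κ => P) (X := fun _ => g) fun _ => hg
  simp only [Finset.sum_const, Finset.card_univ, nsmul_eq_mul] at this
  rw [← this]
  congr 1
  ext o
  simp

lemma pi_meas_ge_le_variance {κ : Type*} [Fintype κ] {g : O → ℝ} (hg : MemLp g 2 P)
    {η : ℝ} (hη : 0 < η) :
    (Measure.pi fun _ : κ => P) {o | η ≤ |∑ i, g (o i) - Fintype.card κ * ∫ o, g o ∂P|} ≤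
      ENNReal.ofReal (Fintype.card κ * Var[g; P] / η ^ 2) := by
  have := meas_ge_le_variance_div_sq (memLp_sum_pi (κ := κ) P hg) hη
  rwa [integral_sum_pi P (hg.integrable one_le_two), variance_sum_pi_const P hg] at this

lemma tendsto_pi_mean {g : O → ℝ} (hg : MemLp g 2 P) {ε : ℝ} (hε : 0 < ε) :
    Tendsto (fun n : ℕ => (Measure.pi fun _ : Fin n => P)
      {o | ε ≤ |(∑ i, g (o i)) / n - ∫ o, g o ∂P|}) atTop (𝓝 0) := by
  have hb : Tendsto (fun n : ℕ => ENNReal.ofReal (Var[g; P] / ε ^ 2 * (n : ℝ)⁻¹)) atTop (𝓝 0) := by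
    rw [← ENNReal.ofReal_zero]
    refine ENNReal.tendsto_ofReal ?_
    simpa using (tendsto_inv_atTop_nhds_zero_nat (𝕜 := ℝ)).const_mul (Var[g; P] / ε ^ 2)
  refine tendsto_of_tendsto_of_tendsto_of_le_of_le' tendsto_const_nhds hb
    (Eventually.of_forall fun _ => zero_le) ?_
  filter_upwards [eventually_gt_atTop 0] with n hn
  have hn' : (0 : ℝ) < n := by exact_mod_cast hn
  have := pi_meas_ge_le_variance (κ := Fin n) P hg (η := ε * n) (by positivity)
  simp only [Fintype.card_fin] at this
  refine (measure_mono fun o ho => ?_).trans (this.trans_eq ?_)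
  · simp only [Set.mem_ofPred_eq] at ho ⊢
    have h2 : ∑ i, g (o i) - n * ∫ o, g o ∂P = ((∑ i, g (o i)) / n - ∫ o, g o ∂P) * n := by
      field_simp
    rw [h2, abs_mul, abs_of_pos hn']
    gcongr
  · congr 1
    field_simp

lemma measurePreserving_infinitePi_fin (n : ℕ) :
    MeasurePreserving (fun (ω : ℕ → O) (i : Fin n) => ω i) (Measure.infinitePi fun _ : ℕ => P)
      (Measure.pi fun _ : Fin n => P) where
  measurable := by fun_prop
  map_eq := by
    rw [Measure.map_infinitePi_infinitePi_of_inj (P := fun _ : ℕ => P) (f := fun i : Fin n => (i : ℕ))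
      Fin.val_injective, Measure.infinitePi_eq_pi]

/-- The first `n` coordinates of an infinite i.i.d. sequence have the finite product law, so the
classical central limit theorem transfers: convergence in distribution sees only the law for each
`n`. -/
lemma tendstoInDistribution_pi_sum {g : O → ℝ} (hgm : Measurable g) (hg : MemLp g 2 P) :
    TendstoInDistribution
      (fun (n : ℕ) (o : Fin n → O) => (√n)⁻¹ * (∑ i, g (o i) - n * ∫ o, g o ∂P)) atTop id
      (fun n => Measure.pi fun _ : Fin n => P) (gaussianReal 0 Var[g; P].toNNReal) := by
  have hev := measurePreserving_eval_infinitePi (fun _ : ℕ => P)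
  have hid : ∀ i, IdentDistrib (fun ω : ℕ → O => g (ω i)) g (Measure.infinitePi fun _ : ℕ => P) P := by
    intro i
    refine ⟨(hgm.comp (measurable_pi_apply i)).aemeasurable, hgm.aemeasurable, ?_⟩
    conv_rhs => rw [← (hev i).map_eq, Measure.map_map hgm (hev i).measurable]
    rfl
  have hclt := tendstoInDistribution_inv_sqrt_mul_sum_sub
    (P := Measure.infinitePi fun _ : ℕ => P) (X := fun i ω => g (ω i))
    (P' := gaussianReal 0 Var[g; P].toNNReal) (Y := id)
    (by rw [(hid 0).variance_eq]; exact HasLaw.id) ((hid 0).memLp_iff.2 hg)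
    (iIndepFun_infinitePi (X := fun _ => g) fun _ => hgm)
    (fun i => (hid i).trans (hid 0).symm)
  have hm : ∀ n : ℕ, Measurable
      fun o : Fin n → O => (√n)⁻¹ * (∑ i, g (o i) - n * ∫ o, g o ∂P) := fun n => by fun_prop
  refine ⟨fun n => (hm n).aemeasurable, aemeasurable_id, ?_⟩
  refine hclt.tendsto.congr fun n => Subtype.ext ?_
  change Measure.map _ _ = Measure.map _ _
  symm
  rw [← (measurePreserving_infinitePi_fin P n).map_eq,
    Measure.map_map (hm n) (measurePreserving_infinitePi_fin P n).measurable]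
  congr 1
  ext ω
  simp only [Function.comp_apply, (hid 0).integral_eq, Finset.sum_range]

/-- The central limit theorem for i.i.d. centred vectors, for samples under a product measure. -/
lemma tendstoInDistribution_pi_sum_euclidean {ι : Type*} [Fintype ι] [DecidableEq ι]
    {g : ι → O → ℝ} (hgm : ∀ a, Measurable (g a)) (hg : ∀ a, MemLp (g a) 2 P)
    (hg0 : ∀ a, ∫ o, g a o ∂P = 0) {S : Matrix ι ι ℝ} (hS : S.PosSemidef)
    (hcov : ∀ a b, S a b = ∫ o, g a o * g b o ∂P) :
    TendstoInDistribution
      (fun (n : ℕ) (o : Fin n → O) => WithLp.toLp 2 fun a => (√n)⁻¹ * ∑ i, g a (o i)) atTop id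
      (fun n => Measure.pi fun _ : Fin n => P) (multivariateGaussian 0 S) := by
  have hm : ∀ n : ℕ, Measurable (fun o : Fin n → O =>
      (WithLp.toLp 2 fun a => (√n)⁻¹ * ∑ i, g a (o i) : EuclideanSpace ℝ ι)) := fun n => by
    refine (WithLp.measurable_toLp 2 _).comp (measurable_pi_lambda _ fun a => ?_)
    fun_prop
  refine ⟨fun n => (hm n).aemeasurable, aemeasurable_id, ?_⟩
  refine ProbabilityMeasure.tendsto_iff_tendsto_charFun.2 fun t => ?_
  set h : O → ℝ := fun o => ∑ a, t a * g a o with hh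
  have hhm : Measurable h := by fun_prop
  have hh2 : MemLp h 2 P := memLp_finsetSum _ fun a _ => (hg a).const_mul _
  have hh0 : ∫ o, h o ∂P = 0 := by
    rw [hh, integral_finsetSum _ fun a _ => ((hg a).integrable one_le_two).const_mul _]
    simp [integral_const_mul, hg0]
  have hvar : Var[h; P] = t ⬝ᵥ S.mulVec t := by
    rw [variance_of_integral_eq_zero hhm.aemeasurable hh0]
    have : ∀ o, h o ^ 2 = ∑ a, ∑ b, t a * t b * (g a o * g b o) := by
      intro o
      simp only [hh, sq, Finset.sum_mul_sum]
      refine Finset.sum_congr rfl fun a _ => Finset.sum_congr rfl fun b _ => by ring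
    simp_rw [this]
    have hint : ∀ a b, Integrable (fun o => t a * t b * (g a o * g b o)) P := fun a b =>
      ((hg a).integrable_mul (hg b)).const_mul _
    rw [integral_finsetSum _ fun a _ => integrable_finsetSum _ fun b _ => hint a b]
    simp_rw [integral_finsetSum _ fun b _ => hint _ b, integral_const_mul, ← hcov]
    simp only [dotProduct, Matrix.mulVec, Finset.mul_sum]
    refine Finset.sum_congr rfl fun a _ => Finset.sum_congr rfl fun b _ => by ring
  -- Cramér–Wold: the characteristic function of the vector at `t` is that of the scalar sum of `h =
  -- ⟨t, g⟩` at `1`.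
  have h1 := (ProbabilityMeasure.tendsto_iff_tendsto_charFun.1
    (tendstoInDistribution_pi_sum P hhm hh2).tendsto) 1
  simp only [ProbabilityMeasure.coe_mk, Measure.map_id] at h1 ⊢
  rw [charFun_multivariateGaussian hS]
  rw [charFun_gaussianReal, hvar] at h1
  have hnn : 0 ≤ t ⬝ᵥ S.mulVec t := by rw [← hvar]; exact variance_nonneg _ _
  convert h1 using 2
  · rename_i n
    have hm' : Measurable fun o : Fin n → O => (√n)⁻¹ * (∑ i, h (o i) - n * ∫ o, h o ∂P) := by
      generalize ∫ o, h o ∂P = c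
      fun_prop
    rw [charFun_apply, charFun_apply, integral_map (hm n).aemeasurable (by fun_prop),
      integral_map hm'.aemeasurable (by fun_prop)]
    refine integral_congr_ae (Eventually.of_forall fun o => ?_)
    rw [hh0]
    simp only [mul_zero, sub_zero, PiLp.inner_apply, RCLike.inner_apply, conj_trivial, hh,
      one_mul]
    congr 3
    rw [Finset.sum_comm]
    simp_rw [Finset.mul_sum]
    refine Finset.sum_congr rfl fun a _ => Finset.sum_congr rfl fun i _ => by ring
  · simp [hnn]

end PiSums

/-! ### The limit in the number of simulations -/

lemma lt_empiricalQuantile_iff {m : ℕ} (hm : 0 < m) {α : ℝ} (hα : α ∈ Set.Ioo (0 : ℝ) 1)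
    {E : Type*} (f : E → ℝ) (θ : ℝ) (ρ : Fin m → E) :
    θ < empiricalQuantile α (fun s => f (ρ s)) ↔
      (∑ s, (f ⁻¹' Set.Iic θ).indicator (fun _ => (1 : ℝ)) (ρ s)) / m < α := by
  rw [← not_le, empiricalQuantile_le_iff hm hα, natCard_eq_sum_indicator, not_le]
  rfl

section InnerLimit

variable {E : Type*} [MeasurableSpace E] (ν : Measure E) [IsProbabilityMeasure ν]

/-- The probability that the empirical quantile of `m` i.i.d. variables exceeds a threshold has a
limit as `m → ∞`, also when the threshold is the exact quantile. -/
lemma exists_tendsto_pi_lt_empiricalQuantile {α : ℝ} (hα : α ∈ Set.Ioo (0 : ℝ) 1) {f : E → ℝ}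
    (hf : Measurable f) (θ : ℝ) :
    ∃ L : ℝ≥0∞, Tendsto (fun m : ℕ => (Measure.pi fun _ : Fin m => ν)
      {ρ | θ < empiricalQuantile α fun s => f (ρ s)}) atTop (𝓝 L) ∧
      (ENNReal.ofReal α < ν {x | f x ≤ θ} → L = 0) := by
  set A : Set E := f ⁻¹' Set.Iic θ with hA
  have hAm : MeasurableSet A := hf measurableSet_Iic
  set g : E → ℝ := A.indicator fun _ => (1 : ℝ) with hg
  have hgm : Measurable g := measurable_const.indicator hAm
  have hg2 : MemLp g 2 ν := (memLp_const 1).indicator hAm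
  have hq : ∫ x, g x ∂ν = ν.real A := by
    rw [hg, integral_indicator_const _ hAm]
    simp
  have hqα : ENNReal.ofReal α < ν A ↔ α < ν.real A :=
    ENNReal.ofReal_lt_iff_lt_toReal hα.1.le (measure_ne_top _ _)
  have hev : ∀ m : ℕ, 0 < m → {ρ : Fin m → E | θ < empiricalQuantile α fun s => f (ρ s)} =
      {ρ | (∑ s, g (ρ s)) / m < α} := fun m hm => by
    ext ρ
    exact lt_empiricalQuantile_iff hm hα f θ ρ
  rcases lt_trichotomy α (ν.real A) with h | h | h
  -- When `ν A ≠ α`, the weak law decides on which side of `α` the empirical fraction falls.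
  · refine ⟨0, ?_, fun _ => rfl⟩
    refine tendsto_of_tendsto_of_tendsto_of_le_of_le' tendsto_const_nhds
      (tendsto_pi_mean ν hg2 (sub_pos.2 h)) (Eventually.of_forall fun _ => zero_le) ?_
    filter_upwards [eventually_gt_atTop 0] with m hm
    rw [hev m hm, hq]
    refine measure_mono fun ρ hρ => ?_
    simp only [Set.mem_ofPred_eq] at hρ ⊢
    rw [abs_sub_comm]
    exact le_trans (by linarith) (le_abs_self _)
  -- In the tie `ν A = α` the event says that the centred count is negative. Its limiting
  -- probability is the Gaussian mass of the negative half-line; the variance `α (1 - α)` is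
  -- positive, so the boundary `{0}` is null.
  · have hvar : Var[g; ν].toNNReal ≠ 0 := by
      have h2 : ∫ x, g x ^ 2 ∂ν = ∫ x, g x ∂ν := by
        congr 1
        ext x
        by_cases hx : x ∈ A <;> simp [hg, hx]
      have : Var[g; ν] = α * (1 - α) := by
        rw [variance_eq_sub hg2]
        simp only [Pi.pow_apply]
        rw [h2, hq, ← h]
        ring
      rw [this, ne_eq, Real.toNNReal_eq_zero, not_le]
      exact mul_pos hα.1 (sub_pos.2 hα.2)
    have := nullSingletonClass_gaussianReal (μ := 0) hvar
    have hclt := tendstoInDistribution_pi_sum ν hgm hg2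
    have hlim := ProbabilityMeasure.tendsto_measure_of_null_frontier_of_tendsto' hclt.tendsto
      (E := Set.Iio 0) (by simp)
    refine ⟨_, hlim.congr' ?_, fun h' => absurd (hqα.1 h') (by rw [← h]; exact lt_irrefl _)⟩
    filter_upwards [eventually_gt_atTop 0] with m hm
    have hm' : (0 : ℝ) < m := by exact_mod_cast hm
    rw [hev m hm, ProbabilityMeasure.coe_mk,
      Measure.map_apply_of_aemeasurable (hclt.forall_aemeasurable m) measurableSet_Iio, hq, ← h]
    congr 1
    ext ρ
    simp only [Set.mem_preimage, Set.mem_Iio, Set.mem_ofPred_eq]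
    rw [div_lt_iff₀ hm', ← sub_neg (b := α * (m : ℝ)), mul_comm (m : ℝ)]
    have hs : 0 < (√(m : ℝ))⁻¹ := by positivity
    exact ⟨fun h => (pos_iff_neg_of_mul_neg h).1 hs, fun h => mul_neg_of_pos_of_neg hs h⟩
  · refine ⟨1, ?_, fun h' => absurd (hqα.1 h') (by linarith)⟩
    have hc := tendsto_pi_mean ν hg2 (sub_pos.2 h)
    have h1 : Tendsto (fun m : ℕ => 1 - (Measure.pi fun _ : Fin m => ν)
        {o | α - ν.real A ≤ |(∑ i, g (o i)) / m - ∫ o, g o ∂ν|}) atTop (𝓝 1) := by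
      simpa using ENNReal.Tendsto.sub (tendsto_const_nhds (x := (1 : ℝ≥0∞))) hc (by simp)
    refine tendsto_of_tendsto_of_tendsto_of_le_of_le' h1 tendsto_const_nhds ?_
      (Eventually.of_forall fun _ => prob_le_one)
    filter_upwards [eventually_gt_atTop 0] with m hm
    rw [tsub_le_iff_right, hev m hm, ← measure_univ (μ := Measure.pi fun _ : Fin m => ν)]
    refine (measure_mono fun ρ _ => ?_).trans (measure_union_le _ _)
    simp only [Set.mem_union, Set.mem_ofPred_eq, hq]
    by_cases hρ : (∑ s, g (ρ s)) / m < α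
    · exact Or.inl hρ
    · refine Or.inr (le_trans ?_ (le_abs_self _))
      linarith

end InnerLimit

/-! ### Gaussian vectors -/

section SqrtContinuity

open scoped Matrix.Norms.L2Operator MatrixOrder

/-- A Gaussian vector is the root of its covariance applied to a standard one. Continuity of the
root therefore gives both measurability in the covariance and pointwise convergence when covariances
converge. -/
lemma continuousOn_cfcSqrt {ι : Type*} [Fintype ι] [DecidableEq ι] :
    ContinuousOn (fun S : Matrix ι ι ℝ => CFC.sqrt S) {S | S.PosSemidef} :=
  ContinuousOn.cfcₙ_nnreal_of_mem_nhdsSet (A := Matrix ι ι ℝ) (X := Matrix ι ι ℝ)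
    (s := Set.univ) (t := {S : Matrix ι ι ℝ | S.PosSemidef}) (a := id) NNReal.sqrt
    Filter.univ_mem continuousOn_id (fun x hx => Matrix.PosSemidef.nonneg hx) (by fun_prop)
    (by simp)

end SqrtContinuity

/-- A form of Fatou's lemma for sets. -/
lemma measure_le_of_forall_eventually_mem {Ω : Type*} [MeasurableSpace Ω] (μ : Measure Ω)
    {G : Set Ω} {E : ℕ → Set Ω} (hG : MeasurableSet G) (hE : ∀ k, MeasurableSet (E k))
    (hev : ∀ z ∈ G, ∀ᶠ k in atTop, z ∈ E k) {β : ℝ≥0∞} (hβ : ∀ k, μ (E k) ≤ β) : μ G ≤ β := by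
  calc μ G = ∫⁻ z, G.indicator 1 z ∂μ := (lintegral_indicator_one hG).symm
    _ ≤ ∫⁻ z, liminf (fun k => (E k).indicator (1 : Ω → ℝ≥0∞) z) atTop ∂μ := by
        refine lintegral_mono fun z => ?_
        by_cases hz : z ∈ G
        · refine le_liminf_of_le (by isBoundedDefault) ?_
          filter_upwards [hev z hz] with k hk
          simp [hz, hk]
        · simp [hz]
    _ ≤ liminf (fun k => ∫⁻ z, (E k).indicator (1 : Ω → ℝ≥0∞) z ∂μ) atTop :=
        lintegral_liminf_le fun k => measurable_one.indicator (hE k)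
    _ ≤ liminf (fun _ : ℕ => β) atTop := by
        refine liminf_le_liminf (Eventually.of_forall fun k => ?_)
        rw [lintegral_indicator_one (hE k)]
        exact hβ k
    _ = β := by simp

lemma measurableSet_exists_div_le {ι : Type*} (N : Finset ι) (σ : ι → ℝ) (t : ℝ) :
    MeasurableSet {ρ : EuclideanSpace ℝ ι | ∃ b ∈ N, ρ b / σ b ≤ t} := by
  have : {ρ : EuclideanSpace ℝ ι | ∃ b ∈ N, ρ b / σ b ≤ t} = ⋃ b ∈ N, {ρ | ρ b / σ b ≤ t} := by
    ext ρ
    simp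
  rw [this]
  refine Finset.measurableSet_biUnion _ fun b _ => measurableSet_le ?_ measurable_const
  fun_prop

section Gaussian

open scoped MatrixOrder

variable {ι : Type*} [Fintype ι] [DecidableEq ι]

/-- The linear image of `z` under the square root of `S`; for a standard Gaussian `z` it has law
`N(0, S)`. -/
def sqrtMap (S : Matrix ι ι ℝ) (z : EuclideanSpace ℝ ι) : EuclideanSpace ℝ ι :=
  Matrix.toEuclideanCLM (𝕜 := ℝ) (CFC.sqrt S) z

lemma sqrtMap_apply (S : Matrix ι ι ℝ) (z : EuclideanSpace ℝ ι) (a : ι) :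
    sqrtMap S z a = ∑ b, CFC.sqrt S a b * z b := by
  simp [sqrtMap, Matrix.mulVec, dotProduct]

lemma measurable_sqrtMap (S : Matrix ι ι ℝ) : Measurable (sqrtMap S) := by
  unfold sqrtMap
  fun_prop

lemma multivariateGaussian_eq_map (S : Matrix ι ι ℝ) :
    multivariateGaussian 0 S = (stdGaussian (EuclideanSpace ℝ ι)).map (sqrtMap S) := by
  unfold sqrtMap multivariateGaussian
  simp

/-- The root is continuous only on positive semidefinite matrices, hence the factorization through
that subtype; functions `ι → ι → ℝ` carry the product measurable structure in which entrywise
measurability suffices. -/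
lemma measurable_cfcSqrt {Ω : Type*} [MeasurableSpace Ω] {S : Ω → Matrix ι ι ℝ}
    (hS : ∀ ω, (S ω).PosSemidef) (hm : ∀ a b, Measurable fun ω => S ω a b) (a b : ι) :
    Measurable fun ω => CFC.sqrt (S ω) a b := by
  have h1 : Continuous fun S : {S : ι → ι → ℝ // Matrix.PosSemidef (Matrix.of S)} =>
      CFC.sqrt (Matrix.of S.1) a b := by
    have h0 : Continuous fun S : {S : ι → ι → ℝ // Matrix.PosSemidef (Matrix.of S)} =>
        (CFC.sqrt (Matrix.of S.1) : Matrix ι ι ℝ) :=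
      continuousOn_cfcSqrt.comp_continuous (f := fun
        S : {S : ι → ι → ℝ // Matrix.PosSemidef (Matrix.of S)} => Matrix.of S.1)
        continuous_subtype_val fun S => S.2
    exact h0.matrix_elem a b
  have h2 : Measurable fun ω => (⟨fun a b => S ω a b, hS ω⟩ :
      {S : ι → ι → ℝ // Matrix.PosSemidef (Matrix.of S)}) :=
    Measurable.subtype_mk (measurable_pi_lambda _ fun a => measurable_pi_lambda _ fun b => hm a b)
  exact h1.measurable.comp h2

lemma measurable_uncurry_sqrtMap {Ω : Type*} [MeasurableSpace Ω] {S : Ω → Matrix ι ι ℝ}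
    (hS : ∀ ω, (S ω).PosSemidef) (hm : ∀ a b, Measurable fun ω => S ω a b) (a : ι) :
    Measurable fun p : Ω × EuclideanSpace ℝ ι => sqrtMap (S p.1) p.2 a := by
  simp_rw [sqrtMap_apply]
  refine Finset.measurable_sum _ fun b _ => Measurable.mul ?_ ?_
  · exact (measurable_cfcSqrt hS hm a b).comp measurable_fst
  · fun_prop

lemma multivariateGaussian_setOf_eq_null {S : Matrix ι ι ℝ} (hS : S.PosSemidef) {b : ι}
    (hb : 0 < S b b) (t : ℝ) :
    multivariateGaussian 0 S {ρ | ρ b / √(S b b) = t} = 0 := by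
  have hmp := measurePreserving_eval_multivariateGaussian (μ := 0) hS (i := b)
  have := nullSingletonClass_gaussianReal (μ := (0 : EuclideanSpace ℝ ι) b) (v := (S b b).toNNReal)
    (by simpa using hb)
  have h0 : multivariateGaussian 0 S ((fun ρ : EuclideanSpace ℝ ι => ρ b) ⁻¹' {t * √(S b b)}) = 0 := by
    rw [hmp.measure_preimage (measurableSet_singleton _).nullMeasurableSet]
    exact measure_singleton _
  refine measure_mono_null (fun ρ hρ => ?_) h0
  have : √(S b b) ≠ 0 := (Real.sqrt_pos.2 hb).ne'
  simp only [Set.mem_ofPred_eq, Set.mem_preimage, Set.mem_singleton_iff] at hρ ⊢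
  rw [← hρ, div_mul_cancel₀ _ this]

/-- The pairs of a vector `x` and a covariance matrix `S` for which a Gaussian vector with
covariance `S` has, with probability at most `β`, a studentized coordinate in `N` that is at most
the studentized `a`-th coordinate of `x`. -/
def rejectSet (N : Finset ι) (β : ℝ≥0∞) (a : ι) : Set (EuclideanSpace ℝ ι × (ι → ι → ℝ)) :=
  {p | (Matrix.of p.2).PosSemidef ∧ multivariateGaussian 0 (Matrix.of p.2)
    {ρ | ∃ b ∈ N, ρ b / √(p.2 b b) ≤ p.1 a / √(p.2 a a)} ≤ β}

/-- All the Gaussian laws along an approximating sequence are coupled through one standard vector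
`z`. A strict inequality in the limit then holds eventually along the sequence, so Fatou bounds the
strict event. Ties are null because the coordinates in `N` have positive variance, which also makes
studentization continuous at `S`. -/
lemma mem_rejectSet_of_mem_closure {N : Finset ι} {β : ℝ≥0∞} {a : ι} (ha : a ∈ N)
    {x : EuclideanSpace ℝ ι} {S : ι → ι → ℝ} (hS : (Matrix.of S).PosSemidef)
    (hpos : ∀ b ∈ N, 0 < S b b) (hx : (x, S) ∈ closure (rejectSet N β a)) :
    (x, S) ∈ rejectSet N β a := by
  obtain ⟨p, hp, hlim⟩ := mem_closure_iff_seq_limit.1 hx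
  refine ⟨hS, ?_⟩
  have hx1 : ∀ b, Tendsto (fun k => (p k).1 b) atTop (𝓝 (x b)) := fun b =>
    ((EuclideanSpace.proj (𝕜 := ℝ) b).continuous.tendsto x).comp hlim.fst_nhds
  have hS1 : Tendsto (fun k => (p k).2) atTop (𝓝 S) := hlim.snd_nhds
  have hS2 : ∀ b, Tendsto (fun k => (p k).2 b b) atTop (𝓝 (S b b)) := fun b =>
    (tendsto_pi_nhds.1 (tendsto_pi_nhds.1 hS1 b) b)
  have hsq : Tendsto (fun k => (CFC.sqrt (Matrix.of (p k).2) : Matrix ι ι ℝ)) atTop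
      (𝓝 (CFC.sqrt (Matrix.of S))) :=
    (continuousOn_cfcSqrt (Matrix.of S) hS).tendsto.comp
      (tendsto_nhdsWithin_iff.2 ⟨hS1, Eventually.of_forall fun k => (hp k).1⟩)
  have hsq2 : ∀ c b, Tendsto (fun k => (CFC.sqrt (Matrix.of (p k).2) : Matrix ι ι ℝ) c b) atTop
      (𝓝 (CFC.sqrt (Matrix.of S) c b)) := fun c b =>
    tendsto_pi_nhds.1 (tendsto_pi_nhds.1 hsq c) b
  have hmap : ∀ (z : EuclideanSpace ℝ ι) b, Tendsto (fun k => sqrtMap (Matrix.of (p k).2) z b)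
      atTop (𝓝 (sqrtMap (Matrix.of S) z b)) := fun z b => by
    simp_rw [sqrtMap_apply]
    exact tendsto_finsetSum _ fun c _ => (hsq2 b c).mul_const _
  set t : ℕ → ℝ := fun k => (p k).1 a / √((p k).2 a a) with ht
  have htl : Tendsto t atTop (𝓝 (x a / √(S a a))) :=
    (hx1 a).div (hS2 a).sqrt (Real.sqrt_pos.2 (hpos a ha)).ne'
  set E : ℕ → Set (EuclideanSpace ℝ ι) := fun k =>
    sqrtMap (Matrix.of (p k).2) ⁻¹' {ρ | ∃ b ∈ N, ρ b / √((p k).2 b b) ≤ t k} with hE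
  have hEm : ∀ k, MeasurableSet (E k) := fun k =>
    measurable_sqrtMap _ (measurableSet_exists_div_le N _ _)
  set G : Set (EuclideanSpace ℝ ι) := {ρ | ∃ b ∈ N, ρ b / √(S b b) < x a / √(S a a)} with hG
  have hGm : MeasurableSet G := by
    have : G = ⋃ b ∈ N, {ρ | ρ b / √(S b b) < x a / √(S a a)} := by
      ext ρ
      simp [hG]
    rw [this]
    refine Finset.measurableSet_biUnion _ fun b _ => measurableSet_lt ?_ measurable_const
    fun_prop
  have hev : ∀ z, sqrtMap (Matrix.of S) z ∈ G → ∀ᶠ k in atTop, z ∈ E k := by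
    rintro z ⟨b, hb, hlt⟩
    have h1 : Tendsto (fun k => sqrtMap (Matrix.of (p k).2) z b / √((p k).2 b b)) atTop
        (𝓝 (sqrtMap (Matrix.of S) z b / √(S b b))) :=
      (hmap z b).div (hS2 b).sqrt (Real.sqrt_pos.2 (hpos b hb)).ne'
    filter_upwards [h1.eventually_lt htl hlt] with k hk
    exact ⟨b, hb, hk.le⟩
  have hopen : multivariateGaussian 0 (Matrix.of S) G ≤ β := by
    rw [multivariateGaussian_eq_map, Measure.map_apply (measurable_sqrtMap _) hGm]
    refine measure_le_of_forall_eventually_mem _ (measurable_sqrtMap _ hGm) hEm hev fun k => ?_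
    have := (hp k).2
    rwa [multivariateGaussian_eq_map, Measure.map_apply (measurable_sqrtMap _)
      (measurableSet_exists_div_le N _ _)] at this
  have hnull : multivariateGaussian 0 (Matrix.of S)
      (⋃ b ∈ N, {ρ | ρ b / √(S b b) = x a / √(S a a)}) = 0 := by
    exact (measure_biUnion_null_iff N.countable_toSet).2 fun b hb =>
      multivariateGaussian_setOf_eq_null hS (hpos b hb) _
  refine le_trans (measure_mono (t := G ∪ ⋃ b ∈ N, {ρ | ρ b / √(S b b) = x a / √(S a a)}) ?_)
    ((measure_union_le _ _).trans (by rw [hnull, add_zero]; exact hopen))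
  rintro ρ ⟨b, hb, hle⟩
  rcases hle.lt_or_eq with h | h
  · exact Or.inl ⟨b, hb, h⟩
  · exact Or.inr (Set.mem_biUnion (Finset.mem_coe.2 hb) h)

/-- The probability integral transform for an arbitrary law. By inner regularity it is enough to
bound compact subsets, and a compact subset lies below its own maximum, whose distribution function
value is at most `β`. No continuity is needed. -/
lemma measure_setOf_cdf_le (ν : Measure ℝ) [IsProbabilityMeasure ν] (β : ℝ≥0∞) :
    ν {w | ν (Set.Iic w) ≤ β} ≤ β := by
  have hm : MeasurableSet {w | ν (Set.Iic w) ≤ β} := by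
    refine Set.OrdConnected.measurableSet ⟨fun x _ y hy z hz => ?_⟩
    exact (measure_mono (Set.Iic_subset_Iic.2 hz.2)).trans hy
  rw [hm.measure_eq_iSup_isCompact]
  refine iSup_le fun K => iSup_le fun hK => iSup_le fun hc => ?_
  rcases K.eq_empty_or_nonempty with rfl | hne
  · simp
  · obtain ⟨w, hw, hmax⟩ := hc.exists_isGreatest hne
    exact (measure_mono fun y hy => hmax hy).trans (hK hw)

/-- With `W` the studentized minimum over `N`, whose distribution function is monotone, rejection at
any `a` forces rejection at `W x`, which is at most the `a`-th studentized coordinate. Thus the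
union over `a` costs no more than a single probability integral transform. -/
lemma multivariateGaussian_rejectSet_le (N : Finset ι) (β : ℝ≥0∞) (S : ι → ι → ℝ) :
    multivariateGaussian 0 (Matrix.of S) {x | ∃ a ∈ N, (x, S) ∈ rejectSet N β a} ≤ β := by
  rcases N.eq_empty_or_nonempty with rfl | hN
  · simp
  set W : EuclideanSpace ℝ ι → ℝ := fun x => N.inf' hN fun b => x b / √(S b b) with hW
  have hWm : Measurable W := by
    refine measurable_of_Iic fun t => ?_
    have : W ⁻¹' Set.Iic t = {x | ∃ b ∈ N, x b / √(S b b) ≤ t} := by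
      ext x
      exact Finset.inf'_le_iff (f := fun b => x b / √(S b b)) hN
    rw [this]
    exact measurableSet_exists_div_le N _ t
  have hWle : ∀ x t, W x ≤ t ↔ ∃ b ∈ N, x b / √(S b b) ≤ t  := fun x t =>
    Finset.inf'_le_iff (f := fun b => x b / √(S b b)) hN
  set ν := (multivariateGaussian 0 (Matrix.of S)).map W with hν
  have : IsProbabilityMeasure ν := Measure.isProbabilityMeasure_map hWm.aemeasurable
  have hΦ : ∀ t, ν (Set.Iic t) =
      multivariateGaussian 0 (Matrix.of S) {ρ | ∃ b ∈ N, ρ b / √(S b b) ≤ t} := fun t => by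
    rw [hν, Measure.map_apply hWm measurableSet_Iic]
    congr 1
    ext x
    exact hWle x t
  refine le_trans ?_ (measure_setOf_cdf_le ν β)
  refine le_trans (measure_mono ?_) (Measure.le_map_apply hWm.aemeasurable _)
  rintro x ⟨a, ha, -, hle⟩
  simp only [Set.mem_preimage, Set.mem_ofPred_eq]
  refine le_trans (measure_mono (Set.Iic_subset_Iic.2 (Finset.inf'_le (fun b => x b / √(S b b)) ha))) ?_
  rw [hΦ]
  exact hle

end Gaussian

/-! ### Convergence in probability along varying probability spaces -/

section Vanishing

variable {Ω : ℕ → Type*} [∀ n, MeasurableSpace (Ω n)] {P : ∀ n, Measure (Ω n)}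

/-- `X n → 0` in probability, for random variables on varying probability spaces. -/
def VanishesInProb (P : ∀ n, Measure (Ω n)) (X : ∀ n, Ω n → ℝ) : Prop :=
  ∀ ε : ℝ, 0 < ε → Tendsto (fun n => P n {ω | ε ≤ |X n ω|}) atTop (𝓝 0)

lemma tendsto_measure_zero_of_le {s t : ∀ n, Set (Ω n)} (hs : Tendsto (fun n => P n (s n)) atTop (𝓝 0))
    (h : ∀ᶠ n in atTop, P n (t n) ≤ P n (s n)) : Tendsto (fun n => P n (t n)) atTop (𝓝 0) :=
  tendsto_of_tendsto_of_tendsto_of_le_of_le' tendsto_const_nhds hs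
    (Eventually.of_forall fun _ => zero_le) h

namespace VanishesInProb

variable {X Y : ∀ n, Ω n → ℝ}

lemma mono (hY : VanishesInProb P Y) (h : ∀ᶠ n in atTop, ∀ᵐ ω ∂(P n), |X n ω| ≤ |Y n ω|) :
    VanishesInProb P X := fun ε hε => by
  refine tendsto_measure_zero_of_le (hY ε hε) ?_
  filter_upwards [h] with n hn
  refine measure_mono_ae ?_
  filter_upwards [hn] with ω hω h1
  exact le_trans h1 hω

lemma add (hX : VanishesInProb P X) (hY : VanishesInProb P Y) :
    VanishesInProb P fun n ω => X n ω + Y n ω := fun ε hε => by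
  have h := (hX (ε / 2) (by positivity)).add (hY (ε / 2) (by positivity))
  rw [add_zero] at h
  refine tendsto_of_tendsto_of_tendsto_of_le_of_le tendsto_const_nhds h
    (fun _ => zero_le) fun n => ?_
  refine (measure_mono fun ω hω => ?_).trans (measure_union_le _ _)
  simp only [Set.mem_union, Set.mem_ofPred_eq] at hω ⊢
  by_contra! hc
  have := abs_add_le (X n ω) (Y n ω)
  linarith

lemma zero : VanishesInProb P fun _ _ => 0 := fun ε hε => by
  simp [not_le.2 hε]

lemma sum {κ : Type*} {s : Finset κ} {Z : κ → ∀ n, Ω n → ℝ}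
    (hZ : ∀ i ∈ s, VanishesInProb P (Z i)) : VanishesInProb P fun n ω => ∑ i ∈ s, Z i n ω := by
  classical
  induction s using Finset.induction_on with
  | empty => simpa using zero
  | insert i s hi ih =>
    simp_rw [Finset.sum_insert hi]
    exact (hZ i (Finset.mem_insert_self i s)).add
      (ih fun j hj => hZ j (Finset.mem_insert_of_mem hj))

lemma const_mul (c : ℝ) (hX : VanishesInProb P X) : VanishesInProb P fun n ω => c * X n ω :=
  fun ε hε => by
  -- The `+ 1` keeps the threshold meaningful for `c = 0`.
  refine tendsto_measure_zero_of_le (hX (ε / (|c| + 1)) (by positivity))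
    (Eventually.of_forall fun n => measure_mono fun ω hω => ?_)
  simp only [Set.mem_ofPred_eq, abs_mul] at hω ⊢
  rw [div_le_iff₀ (by positivity)]
  nlinarith [abs_nonneg (X n ω)]

lemma abs (hX : VanishesInProb P X) : VanishesInProb P fun n ω => |X n ω| :=
  hX.mono (Eventually.of_forall fun n => Eventually.of_forall fun ω => by simp)

lemma sqrt (hX : VanishesInProb P X) : VanishesInProb P fun n ω => √(X n ω) := fun ε hε => by
  refine tendsto_measure_zero_of_le (hX (ε ^ 2) (by positivity))
    (Eventually.of_forall fun n => measure_mono fun ω hω => ?_)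
  simp only [Set.mem_ofPred_eq, abs_of_nonneg (Real.sqrt_nonneg _)] at hω ⊢
  exact (Real.le_sqrt' hε).1 hω |>.trans (le_abs_self _)

lemma mul (hX : VanishesInProb P X) (hY : VanishesInProb P Y) :
    VanishesInProb P fun n ω => X n ω * Y n ω := fun ε hε => by
  have h := (hX (√ε) (by positivity)).add (hY (√ε) (by positivity))
  rw [add_zero] at h
  refine tendsto_of_tendsto_of_tendsto_of_le_of_le tendsto_const_nhds h
    (fun _ => zero_le) fun n => ?_
  refine (measure_mono fun ω hω => ?_).trans (measure_union_le _ _)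
  simp only [Set.mem_union, Set.mem_ofPred_eq, abs_mul] at hω ⊢
  by_contra! hc
  have : |X n ω| * |Y n ω| < √ε * √ε :=
    mul_lt_mul'' hc.1 hc.2 (abs_nonneg _) (abs_nonneg _)
  rw [Real.mul_self_sqrt hε.le] at this
  linarith

end VanishesInProb

end Vanishing

section Slutsky

variable {Ω : ℕ → Type*} [∀ n, MeasurableSpace (Ω n)] (P : ∀ n, Measure (Ω n))
  [∀ n, IsProbabilityMeasure (P n)]
  {E F : Type*} [NormedAddCommGroup E] [MeasurableSpace E] [BorelSpace E]
  [SecondCountableTopology E] [NormedAddCommGroup F] [MeasurableSpace F] [BorelSpace F]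
  [SecondCountableTopology F]

omit [SecondCountableTopology E] in
-- The samples of different sizes live on different spaces; the infinite product puts them on one,
-- where Slutsky's theorem applies. The dependence between sizes is irrelevant, since only each
-- marginal law enters.
lemma tendstoInMeasure_infinitePi {Y : ∀ n, Ω n → E} (hYm : ∀ n, Measurable (Y n)) {c : E}
    (hY : VanishesInProb P fun n ω => ‖Y n ω - c‖) :
    TendstoInMeasure (Measure.infinitePi P) (fun n ω => Y n (ω n)) atTop fun _ => c := by
  rw [tendstoInMeasure_iff_norm]
  intro ε hε
  refine (hY ε hε).congr fun n => ?_
  have hs : MeasurableSet {ω | ε ≤ |‖Y n ω - c‖|} := by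
    simp only [abs_norm]
    exact measurableSet_le measurable_const ((hYm n).sub_const c).norm
  rw [← (measurePreserving_eval_infinitePi P n).measure_preimage hs.nullMeasurableSet]
  simp [Set.preimage]

/-- Slutsky followed by the closed-set half of the portmanteau theorem. Passing to the closure first
removes any measurability requirement on `K`. -/
lemma limsup_measure_le_of_tendstoInDistribution {μ : Measure E} [IsProbabilityMeasure μ]
    {X R : ∀ n, Ω n → E} {Y : ∀ n, Ω n → F} (hXm : ∀ n, Measurable (X n))
    (hRm : ∀ n, Measurable (R n)) (hYm : ∀ n, Measurable (Y n)) {c : F}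
    (hX : TendstoInDistribution X atTop id P μ) (hR : VanishesInProb P fun n ω => ‖R n ω‖)
    (hY : VanishesInProb P fun n ω => ‖Y n ω - c‖) (K : Set (E × F)) :
    limsup (fun n => P n {ω | (X n ω + R n ω, Y n ω) ∈ K}) atTop ≤
      μ {x | (x, c) ∈ closure K} := by
  have hev := measurePreserving_eval_infinitePi P
  have hX' : TendstoInDistribution (fun n ω => X n (ω n)) atTop id
      (fun _ => Measure.infinitePi P) μ := by
    refine ⟨fun n => ((hXm n).comp (measurable_pi_apply n)).aemeasurable, aemeasurable_id, ?_⟩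
    refine hX.tendsto.congr fun n => Subtype.ext ?_
    change Measure.map _ _ = Measure.map _ _
    conv_lhs => rw [← (hev n).map_eq, Measure.map_map (hXm n) (hev n).measurable]
    rfl
  have hR' := tendstoInMeasure_infinitePi P hRm (c := 0) (by simpa using hR)
  have hY' := tendstoInMeasure_infinitePi P hYm hY
  have hsum := hX'.add_of_tendstoInMeasure_const hR'
    fun n => ((hRm n).comp (measurable_pi_apply n)).aemeasurable
  have hpair := hsum.prodMk_of_tendstoInMeasure_const _ _ _ hY'
    fun n => ((hYm n).comp (measurable_pi_apply n)).aemeasurable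
  have hps := ProbabilityMeasure.limsup_measure_closed_le_of_tendsto hpair.tendsto
    (isClosed_closure (s := K))
  have hpm : ∀ n, Measurable fun ω : Ω n => (X n ω + R n ω, Y n ω) := fun n =>
    ((hXm n).add (hRm n)).prodMk (hYm n)
  refine (limsup_le_limsup (Eventually.of_forall fun n => ?_)).trans (hps.trans_eq ?_)
  · have hm : MeasurableSet {ω | (X n ω + R n ω, Y n ω) ∈ closure K} :=
      hpm n isClosed_closure.measurableSet
    rw [ProbabilityMeasure.coe_mk, Measure.map_apply_of_aemeasurable
      (hpair.forall_aemeasurable n) isClosed_closure.measurableSet]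
    refine (measure_mono (t := {ω | (X n ω + R n ω, Y n ω) ∈ closure K})
      fun ω hω => subset_closure (s := K) hω).trans_eq ?_
    rw [← (hev n).measure_preimage hm.nullMeasurableSet]
    rfl
  · rw [ProbabilityMeasure.coe_mk, Measure.map_apply_of_aemeasurable
      hpair.aemeasurable_limit isClosed_closure.measurableSet]
    simp [Set.preimage]

end Slutsky

/-! ### Doubly robust scores -/

lemma measurable_kernel_real {𝒳 : Type*} [MeasurableSpace 𝒳] {K : ℕ} (π : Kernel 𝒳 (Fin K))
    (k : Fin K) : Measurable fun x => (π x).real {k} :=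
  (Kernel.measurable_coe π (measurableSet_singleton k)).ennreal_toReal

lemma sum_kernel_real {𝒳 : Type*} [MeasurableSpace 𝒳] {K : ℕ} (π : Kernel 𝒳 (Fin K))
    [IsMarkovKernel π] (x : 𝒳) : ∑ k, (π x).real {k} = 1 := by
  rw [sum_measureReal_singleton]
  simp

namespace DataModel

variable {𝒳 : Type*} [MeasurableSpace 𝒳] {K d : ℕ} (M : DataModel 𝒳 K d)

instance : IsProbabilityMeasure M.designLaw := by
  unfold designLaw
  infer_instance

instance : IsProbabilityMeasure M.obsLaw := by
  unfold obsLaw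
  infer_instance

lemma measurePreserving_fst_designLaw : MeasurePreserving Prod.fst M.designLaw M.covariateLaw :=
  ⟨measurable_fst, Measure.fst_compProd M.covariateLaw M.treatmentLaw⟩

lemma measurePreserving_fst_obsLaw : MeasurePreserving Prod.fst M.obsLaw M.designLaw :=
  ⟨measurable_fst, Measure.fst_compProd _ _⟩

lemma measurable_propensity (k : Fin K) : Measurable (M.propensity k) :=
  measurable_kernel_real _ k

lemma sum_propensity (x : 𝒳) : ∑ k, M.propensity k x = 1 := sum_kernel_real _ x

lemma measurable_outcome (j : Fin d) : Measurable fun y : Fin d → unitInterval => (y j : ℝ) :=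
  measurable_subtype_coe.comp (measurable_pi_apply j)

lemma integrable_outcome (q : 𝒳 × Fin K) (j : Fin d) :
    Integrable (fun y : Fin d → unitInterval => (y j : ℝ)) (M.outcomeLaw q) :=
  Integrable.of_bound (measurable_outcome j).aestronglyMeasurable 1
    (Eventually.of_forall fun y => by
      rw [Real.norm_of_nonneg (y j).2.1]
      exact (y j).2.2)

lemma measurable_outcomeMean (j : Fin d) (k : Fin K) : Measurable (M.outcomeMean j k) := by
  have : StronglyMeasurable fun q => ∫ y, (y j : ℝ) ∂(M.outcomeLaw q) :=
    ((measurable_outcome j).comp measurable_snd).stronglyMeasurable.integral_kernel_prod_right'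
      (κ := M.outcomeLaw)
  exact this.measurable.comp (measurable_id.prodMk measurable_const)

lemma outcomeMean_nonneg (j : Fin d) (k : Fin K) (x : 𝒳) : 0 ≤ M.outcomeMean j k x :=
  integral_nonneg fun y => (y j).2.1

lemma outcomeMean_le_one (j : Fin d) (k : Fin K) (x : 𝒳) : M.outcomeMean j k x ≤ 1 := by
  unfold outcomeMean
  calc ∫ y, (y j : ℝ) ∂(M.outcomeLaw (x, k)) ≤ ∫ _, (1 : ℝ) ∂(M.outcomeLaw (x, k)) :=
        integral_mono (M.integrable_outcome _ j) (integrable_const _) fun y => (y j).2.2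
    _ = 1 := by simp

lemma integral_designLaw {f : 𝒳 × Fin K → ℝ} (hf : Integrable f M.designLaw) :
    ∫ q, f q ∂M.designLaw = ∫ x, ∑ k, M.propensity k x * f (x, k) ∂M.covariateLaw := by
  unfold designLaw at hf ⊢
  rw [Measure.integral_compProd hf]
  refine integral_congr_ae (Eventually.of_forall fun x => ?_)
  simp only [integral_fintype Integrable.of_finite, smul_eq_mul, propensity]

lemma integrable_sum_propensity_mul {f : 𝒳 × Fin K → ℝ} (hf : Integrable f M.designLaw) :
    Integrable (fun x => ∑ k, M.propensity k x * f (x, k)) M.covariateLaw := by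
  unfold designLaw at hf
  have := Integrable.integral_compProd hf
  refine this.congr (Eventually.of_forall fun x => ?_)
  simp only [integral_fintype Integrable.of_finite, smul_eq_mul, propensity]
  rfl

/-- Joint measurability in a parameter `z` is needed because the regression is itself a function of
the training data. -/
lemma measurable_policyScore {Z : Type*} [MeasurableSpace Z] {m : Z → Fin d → Fin K → 𝒳 → ℝ}
    {j : Fin d} (hm : ∀ k, Measurable fun p : Z × 𝒳 => m p.1 j k p.2) (π : Kernel 𝒳 (Fin K)) :
    Measurable fun p : Z × Obs 𝒳 K d => M.policyScore (m p.1) π j p.2 := by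
  unfold policyScore drScore
  refine Finset.measurable_sum _ fun k _ => ?_
  have hx : Measurable fun p : Z × Obs 𝒳 K d => p.2.1.1 := by fun_prop
  have h1 : Measurable fun p : Z × Obs 𝒳 K d => m p.1 j k p.2.1.1 :=
    (hm k).comp (measurable_fst.prodMk hx)
  have h2 : Measurable fun p : Z × Obs 𝒳 K d => if p.2.1.2 = k then (1 : ℝ) else 0 :=
    (measurable_of_finite fun a : Fin K => if a = k then (1 : ℝ) else 0).comp
      (by fun_prop : Measurable fun p : Z × Obs 𝒳 K d => p.2.1.2)
  have h3 : Measurable fun p : Z × Obs 𝒳 K d => (p.2.2 j : ℝ) :=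
    (measurable_outcome j).comp (by fun_prop)
  exact ((measurable_kernel_real π k).comp hx).mul
    (((h2.mul (h3.sub h1)).div ((M.measurable_propensity k).comp hx)).add h1)

lemma measurable_policyScore_const {m : Fin d → Fin K → 𝒳 → ℝ} {j : Fin d}
    (hm : ∀ k, Measurable (m j k)) (π : Kernel 𝒳 (Fin K)) : Measurable (M.policyScore m π j) := by
  have h1 : ∀ k, Measurable fun p : Unit × 𝒳 => (fun _ : Unit => m) p.1 j k p.2 := fun k =>
    (hm k).comp measurable_snd
  have h2 : Measurable fun o : Obs 𝒳 K d => ((), o) := measurable_prodMk_left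
  have h3 := M.measurable_policyScore (m := fun _ : Unit => m) (j := j) h1 π
  have h4 := h3.comp h2
  simp only [Function.comp_def] at h4
  exact h4

/-- The difference of the policy scores for two regressions with difference `δ`; it only depends on
the covariate and the treatment. -/
def scoreShift (π : Kernel 𝒳 (Fin K)) (δ : Fin K → 𝒳 → ℝ) (q : 𝒳 × Fin K) : ℝ :=
  ∑ k, (π q.1).real {k} * ((1 - (if q.2 = k then (1 : ℝ) else 0) / M.propensity k q.1) * δ k q.1)

lemma policyScore_sub_policyScore (m m' : Fin d → Fin K → 𝒳 → ℝ) (π : Kernel 𝒳 (Fin K))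
    (j : Fin d) (o : Obs 𝒳 K d) :
    M.policyScore m π j o - M.policyScore m' π j o =
      M.scoreShift π (fun k x => m j k x - m' j k x) o.1 := by
  simp only [policyScore, scoreShift, drScore, ← Finset.sum_sub_distrib]
  refine Finset.sum_congr rfl fun k _ => by ring

section Positivity

variable {c : ℝ} (hc : 0 < c) (hpos : ∀ᵐ x ∂M.covariateLaw, ∀ k, c ≤ M.propensity k x)
  (π : Kernel 𝒳 (Fin K)) [IsMarkovKernel π]

include hpos in
lemma ae_designLaw_propensity : ∀ᵐ q ∂M.designLaw, ∀ k, c ≤ M.propensity k q.1 :=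
  M.measurePreserving_fst_designLaw.quasiMeasurePreserving.ae hpos

include hpos in
lemma ae_obsLaw_propensity : ∀ᵐ o ∂M.obsLaw, ∀ k, c ≤ M.propensity k o.1.1 :=
  M.measurePreserving_fst_obsLaw.quasiMeasurePreserving.ae (M.ae_designLaw_propensity hpos)

omit [IsMarkovKernel π] in
lemma measurable_scoreShift {δ : Fin K → 𝒳 → ℝ} (hδ : ∀ k, Measurable (δ k)) :
    Measurable (M.scoreShift π δ) := by
  unfold scoreShift
  refine Finset.measurable_sum _ fun k _ => ?_
  have h2 : Measurable fun q : 𝒳 × Fin K => if q.2 = k then (1 : ℝ) else 0 :=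
    (measurable_of_finite fun a : Fin K => if a = k then (1 : ℝ) else 0).comp measurable_snd
  exact ((measurable_kernel_real π k).comp measurable_fst).mul
    ((measurable_const.sub (h2.div ((M.measurable_propensity k).comp measurable_fst))).mul
      ((hδ k).comp measurable_fst))

include hc in
-- The sum runs over all treatments, also those not received. Positivity allows each term to be
-- weighted by its propensity at the price of `c⁻¹`, which turns the bound into an `L²` norm under
-- the law of `(X, A)` after integration. The factor `K` is Cauchy–Schwarz, and `1 + c⁻¹` bounds the
-- inverse-propensity weight.
lemma sq_scoreShift_le {δ : Fin K → 𝒳 → ℝ} {q : 𝒳 × Fin K}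
    (hq : ∀ k, c ≤ M.propensity k q.1) :
    M.scoreShift π δ q ^ 2 ≤
      K * (1 + c⁻¹) ^ 2 * c⁻¹ * ∑ k, M.propensity k q.1 * δ k q.1 ^ 2 := by
  have hterm : ∀ k, ((π q.1).real {k} *
      ((1 - (if q.2 = k then (1 : ℝ) else 0) / M.propensity k q.1) * δ k q.1)) ^ 2 ≤
      (1 + c⁻¹) ^ 2 * c⁻¹ * (M.propensity k q.1 * δ k q.1 ^ 2) := by
    intro k
    have he : 0 < M.propensity k q.1 := hc.trans_le (hq k)
    have h1 : |1 - (if q.2 = k then (1 : ℝ) else 0) / M.propensity k q.1| ≤ 1 + c⁻¹ := by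
      refine (abs_sub _ _).trans ?_
      rw [abs_one]
      gcongr
      rw [abs_div, abs_of_pos he, div_eq_mul_inv]
      calc |if q.2 = k then (1 : ℝ) else 0| * (M.propensity k q.1)⁻¹ ≤ 1 * c⁻¹ := by
            gcongr
            · split_ifs <;> simp
            · exact hq k
        _ = c⁻¹ := one_mul _
    have h2 : (π q.1).real {k} ≤ 1 := measureReal_le_one
    have h3 : 0 ≤ (π q.1).real {k} := measureReal_nonneg
    have h4 : 1 ≤ c⁻¹ * M.propensity k q.1 := by
      rw [inv_mul_eq_div, one_le_div hc]
      exact hq k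
    calc _ = (π q.1).real {k} ^ 2 *
          (|1 - (if q.2 = k then (1 : ℝ) else 0) / M.propensity k q.1| ^ 2 * δ k q.1 ^ 2) := by
          rw [sq_abs]
          ring
      _ ≤ 1 * ((1 + c⁻¹) ^ 2 * δ k q.1 ^ 2) := by
          gcongr
          exact pow_le_one₀ h3 h2
      _ ≤ (c⁻¹ * M.propensity k q.1) * ((1 + c⁻¹) ^ 2 * δ k q.1 ^ 2) := by gcongr
      _ = _ := by ring
  unfold scoreShift
  refine (sq_sum_le_card_mul_sum_sq).trans ?_
  rw [Finset.card_univ, Fintype.card_fin, mul_assoc (K : ℝ), mul_assoc (K : ℝ),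
    Finset.mul_sum (a := (1 + c⁻¹) ^ 2 * c⁻¹)]
  exact mul_le_mul_of_nonneg_left (Finset.sum_le_sum fun k _ => hterm k) (Nat.cast_nonneg _)

/-- `δ` as a function on the design space. -/
def onDesign (δ : Fin K → 𝒳 → ℝ) (q : 𝒳 × Fin K) : ℝ := δ q.2 q.1

include hc hpos in
lemma integral_sq_scoreShift {δ : Fin K → 𝒳 → ℝ} (hδm : ∀ k, Measurable (δ k))
    (hδ : MemLp (onDesign δ) 2 M.designLaw) :
    MemLp (M.scoreShift π δ) 2 M.designLaw ∧
    ∫ q, M.scoreShift π δ q ^ 2 ∂M.designLaw ≤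
      K * (1 + c⁻¹) ^ 2 * c⁻¹ * ∫ q, onDesign δ q ^ 2 ∂M.designLaw := by
  have hint := M.integrable_sum_propensity_mul hδ.integrable_sq
  have hint' : Integrable (fun q : 𝒳 × Fin K => (K : ℝ) * (1 + c⁻¹) ^ 2 * c⁻¹ *
      ∑ k, M.propensity k q.1 * δ k q.1 ^ 2) M.designLaw :=
    (M.measurePreserving_fst_designLaw.integrable_comp_of_integrable hint).const_mul _
  have hle : ∀ᵐ q ∂M.designLaw, M.scoreShift π δ q ^ 2 ≤
      K * (1 + c⁻¹) ^ 2 * c⁻¹ * ∑ k, M.propensity k q.1 * δ k q.1 ^ 2 := by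
    filter_upwards [M.ae_designLaw_propensity hpos] with q hq
    exact M.sq_scoreShift_le hc π hq
  have hm := M.measurable_scoreShift π hδm
  have hsq : Integrable (fun q => M.scoreShift π δ q ^ 2) M.designLaw := by
    refine hint'.mono' (hm.pow_const 2).aestronglyMeasurable ?_
    filter_upwards [hle] with q hq
    rwa [Real.norm_of_nonneg (sq_nonneg _)]
  refine ⟨(memLp_two_iff_integrable_sq hm.aestronglyMeasurable).2 hsq, ?_⟩
  refine (integral_mono_ae hsq hint' hle).trans_eq ?_
  rw [integral_const_mul, M.integral_designLaw hδ.integrable_sq]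
  have hmp := M.measurePreserving_fst_designLaw
  have := integral_map (μ := M.designLaw) hmp.measurable.aemeasurable
    (f := fun x => ∑ k, M.propensity k x * δ k x ^ 2) (by rw [hmp.map_eq]; exact hint.1)
  rw [hmp.map_eq] at this
  rw [← this]
  rfl

omit [IsMarkovKernel π] in
include hc hpos in
-- Given `X`, the weight `1[A = k] / e(k, X)` has mean `1`, whatever `δ` is. This is where knowing
-- the propensity matters: no bias remains from the regression.
lemma integral_scoreShift {δ : Fin K → 𝒳 → ℝ} 
    (hδ : Integrable (M.scoreShift π δ) M.designLaw) :
    ∫ q, M.scoreShift π δ q ∂M.designLaw = 0 := by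
  rw [M.integral_designLaw hδ]
  refine integral_eq_zero_of_ae ?_
  filter_upwards [hpos] with x hx
  simp only [scoreShift, Finset.mul_sum, Pi.zero_apply]
  rw [Finset.sum_comm]
  refine Finset.sum_eq_zero fun k _ => ?_
  have he : M.propensity k x ≠ 0 := (hc.trans_le (hx k)).ne'
  have : ∀ a, M.propensity a x * ((π x).real {k} *
      ((1 - (if a = k then (1 : ℝ) else 0) / M.propensity k x) * δ k x)) =
      ((π x).real {k} * δ k x) * (M.propensity a x -
        (if a = k then M.propensity a x else 0) / M.propensity k x) := fun a => by
    split_ifs <;> ring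
  simp_rw [this, ← Finset.mul_sum, Finset.sum_sub_distrib, ← Finset.sum_div]
  rw [M.sum_propensity]
  simp [he]

end Positivity

end DataModel

/-! ### Moments and degeneracy of the contrasts of true scores. -/

namespace DataModel

variable {𝒳 : Type*} [MeasurableSpace 𝒳] {K d : ℕ} (M : DataModel 𝒳 K d)

lemma measurable_trueScore (π : Kernel 𝒳 (Fin K)) (j : Fin d) :
    Measurable (M.policyScore M.outcomeMean π j) :=
  M.measurable_policyScore_const (fun k => M.measurable_outcomeMean j k) π

section Positivity

variable {c : ℝ} (hc : 0 < c) (hpos : ∀ᵐ x ∂M.covariateLaw, ∀ k, c ≤ M.propensity k x)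
  (π : Kernel 𝒳 (Fin K)) [IsMarkovKernel π] (j : Fin d)

include hc in
lemma abs_trueScore_le {o : Obs 𝒳 K d} (ho : ∀ k, c ≤ M.propensity k o.1.1) :
    |M.policyScore M.outcomeMean π j o| ≤ c⁻¹ + 1 := by
  have hterm : ∀ k, |M.drScore M.outcomeMean j k o| ≤ c⁻¹ + 1 := fun k => by
    have h0 := M.outcomeMean_nonneg j k o.1.1
    have h1 := M.outcomeMean_le_one j k o.1.1
    have hy0 : (0 : ℝ) ≤ o.2 j := (o.2 j).2.1
    have hy1 : (o.2 j : ℝ) ≤ 1 := (o.2 j).2.2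
    have he : 0 < M.propensity k o.1.1 := hc.trans_le (ho k)
    unfold drScore
    refine (abs_add_le _ _).trans (add_le_add ?_ (abs_le.2 ⟨by linarith, h1⟩))
    rw [abs_div, abs_of_pos he, div_eq_mul_inv, abs_mul]
    calc |if o.1.2 = k then (1 : ℝ) else 0| * |(o.2 j : ℝ) - M.outcomeMean j k o.1.1| *
          (M.propensity k o.1.1)⁻¹ ≤ 1 * 1 * c⁻¹ := by
          gcongr
          · split_ifs <;> simp
          · exact abs_le.2 ⟨by linarith, by linarith⟩
          · exact ho k
      _ = c⁻¹ := by ring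
  unfold policyScore
  calc |∑ k, (π o.1.1).real {k} * M.drScore M.outcomeMean j k o|
      ≤ ∑ k, |(π o.1.1).real {k} * M.drScore M.outcomeMean j k o| :=
        Finset.abs_sum_le_sum_abs _ _
    _ ≤ ∑ k, (π o.1.1).real {k} * (c⁻¹ + 1) := by
        refine Finset.sum_le_sum fun k _ => ?_
        rw [abs_mul, abs_of_nonneg measureReal_nonneg]
        exact mul_le_mul_of_nonneg_left (hterm k) measureReal_nonneg
    _ = c⁻¹ + 1 := by rw [← Finset.sum_mul, sum_kernel_real, one_mul]

include hc hpos in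
lemma memLp_trueScore : MemLp (M.policyScore M.outcomeMean π j) 2 M.obsLaw := by
  refine MemLp.of_bound (M.measurable_trueScore π j).aestronglyMeasurable (c⁻¹ + 1) ?_
  filter_upwards [M.ae_obsLaw_propensity hpos] with o ho
  exact M.abs_trueScore_le hc π j ho

omit [IsMarkovKernel π] in
-- Given `(X, A)`, the residual in the only term with `k = A` has mean zero, so just the regression
-- part survives.
lemma integral_outcomeLaw_trueScore (q : 𝒳 × Fin K) :
    ∫ y, M.policyScore M.outcomeMean π j (q, y) ∂(M.outcomeLaw q) =
      ∑ k, (π q.1).real {k} * M.outcomeMean j k q.1 := by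
  have hform : ∀ y, M.policyScore M.outcomeMean π j (q, y) =
      ∑ k, (π q.1).real {k} * ((if q.2 = k then (1 : ℝ) else 0) / M.propensity k q.1 * (y j : ℝ) +
        (M.outcomeMean j k q.1 - (if q.2 = k then (1 : ℝ) else 0) / M.propensity k q.1 *
          M.outcomeMean j k q.1)) := fun y => by
    unfold policyScore drScore
    refine Finset.sum_congr rfl fun k _ => ?_
    ring
  simp_rw [hform]
  have hint := M.integrable_outcome q j
  rw [integral_finsetSum]
  swap
  · exact fun k _ => ((hint.const_mul _).add (integrable_const _)).const_mul _
  refine Finset.sum_congr rfl fun k _ => ?_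
  rw [integral_const_mul, integral_add (hint.const_mul _) (integrable_const _), integral_const_mul]
  simp only [integral_const, probReal_univ, one_smul]
  by_cases hk : q.2 = k
  · have : ∫ y, (y j : ℝ) ∂(M.outcomeLaw q) = M.outcomeMean j k q.1 := by
      rw [← hk]
      rfl
    rw [this]
    ring
  · simp [hk]

include hc hpos in
lemma integral_trueScore :
    ∫ o, M.policyScore M.outcomeMean π j o ∂M.obsLaw = M.policyValue π j := by
  have hint := (M.memLp_trueScore hc hpos π j).integrable one_le_two
  have hm : Measurable fun x => ∑ k, (π x).real {k} * M.outcomeMean j k x :=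
    Finset.measurable_sum _ fun k _ =>
      (measurable_kernel_real π k).mul (M.measurable_outcomeMean j k)
  have hmp := M.measurePreserving_fst_designLaw
  unfold obsLaw at hint ⊢
  rw [Measure.integral_compProd hint]
  simp_rw [M.integral_outcomeLaw_trueScore π j]
  have := integral_map (μ := M.designLaw) hmp.measurable.aemeasurable
    (f := fun x => ∑ k, (π x).real {k} * M.outcomeMean j k x) hm.aestronglyMeasurable
  rw [hmp.map_eq] at this
  exact this.symm

end Positivity

/-- `d_j(O, π) = ψ_j(O, π; μ, e) - (1 + w) ψ_j(O, π₀; μ, e)`, with the true regression. -/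
def trueDiff (w : ℝ) (π₀ π : Kernel 𝒳 (Fin K)) (j : Fin d) (o : Obs 𝒳 K d) : ℝ :=
  M.policyScore M.outcomeMean π j o - (1 + w) * M.policyScore M.outcomeMean π₀ j o

section TrueDiff

variable {c : ℝ} (hc : 0 < c) (hpos : ∀ᵐ x ∂M.covariateLaw, ∀ k, c ≤ M.propensity k x)
  (w : ℝ) (π₀ π : Kernel 𝒳 (Fin K)) (j : Fin d)

lemma measurable_trueDiff : Measurable (M.trueDiff w π₀ π j) :=
  (M.measurable_trueScore π j).sub ((M.measurable_trueScore π₀ j).const_mul _)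

variable [IsMarkovKernel π₀] [IsMarkovKernel π]

include hc hpos in
lemma ae_abs_trueDiff_le :
    ∀ᵐ o ∂M.obsLaw, |M.trueDiff w π₀ π j o| ≤ (1 + |1 + w|) * (c⁻¹ + 1) := by
  filter_upwards [M.ae_obsLaw_propensity hpos] with o ho
  have h1 := M.abs_trueScore_le hc π j ho
  have h2 := M.abs_trueScore_le hc π₀ j ho
  unfold trueDiff
  calc _ ≤ _ := abs_sub _ _
    _ ≤ (c⁻¹ + 1) + |1 + w| * (c⁻¹ + 1) := by
        rw [abs_mul]
        gcongr
    _ = _ := by ring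

include hc hpos in
lemma memLp_trueDiff : MemLp (M.trueDiff w π₀ π j) 2 M.obsLaw :=
  (M.memLp_trueScore hc hpos π j).sub ((M.memLp_trueScore hc hpos π₀ j).const_mul _)

include hc hpos in
lemma integral_trueDiff : ∫ o, M.trueDiff w π₀ π j o ∂M.obsLaw =
    M.policyValue π j - (1 + w) * M.policyValue π₀ j := by
  unfold trueDiff
  rw [integral_sub ((M.memLp_trueScore hc hpos π j).integrable one_le_two)
    (((M.memLp_trueScore hc hpos π₀ j).integrable one_le_two).const_mul _), integral_const_mul,
    M.integral_trueScore hc hpos, M.integral_trueScore hc hpos]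

omit [IsMarkovKernel π₀] [IsMarkovKernel π] in
/-- The true score is an affine function of the outcome. -/
lemma trueDiff_eq_affine (q : 𝒳 × Fin K) : ∃ b : ℝ, ∀ y, M.trueDiff w π₀ π j (q, y) =
    ((π q.1).real {q.2} - (1 + w) * (π₀ q.1).real {q.2}) / M.propensity q.2 q.1 * (y j : ℝ) + b := by
  have h : ∀ π : Kernel 𝒳 (Fin K), ∃ b : ℝ, ∀ y : Fin d → unitInterval,
      M.policyScore M.outcomeMean π j (q, y) =
        (π q.1).real {q.2} / M.propensity q.2 q.1 * (y j : ℝ) + b := fun π => by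
    refine ⟨∑ k, (π q.1).real {k} * ((if q.2 = k then (1 : ℝ) else 0) *
      (- M.outcomeMean j k q.1) / M.propensity k q.1 + M.outcomeMean j k q.1), fun y => ?_⟩
    have h1 : (π q.1).real {q.2} / M.propensity q.2 q.1 * (y j : ℝ) =
        ∑ k, (π q.1).real {k} * ((if q.2 = k then (1 : ℝ) else 0) * (y j : ℝ) /
          M.propensity k q.1) := by
      rw [Finset.sum_eq_single q.2 (fun k _ hk => by simp [hk.symm]) (by simp)]
      simp only [if_true]
      ring
    rw [h1, ← Finset.sum_add_distrib]
    refine Finset.sum_congr rfl fun k _ => ?_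
    unfold drScore
    ring
  obtain ⟨b, hb⟩ := h π
  obtain ⟨b₀, hb₀⟩ := h π₀
  refine ⟨b - (1 + w) * b₀, fun y => ?_⟩
  unfold trueDiff
  rw [hb, hb₀]
  ring

include hc hpos in
/-- A contrast is degenerate only if the policy is the baseline policy and the weight vanishes. -/
lemma eq_baseline_of_variance_eq_zero {v : ℝ} (hv : 0 < v)
    (hvar : ∀ᵐ x ∂M.covariateLaw, ∀ k, v ≤ M.outcomeVar j k x)
    (h0 : Var[M.trueDiff w π₀ π j; M.obsLaw] = 0) :
    w = 0 ∧ ∀ᵐ x ∂M.covariateLaw, ∀ k, (π x).real {k} = (π₀ x).real {k} := by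
  have hconst := ae_eq_integral_of_variance_eq_zero (M.memLp_trueDiff hc hpos w π₀ π j) h0
  set C := ∫ o, M.trueDiff w π₀ π j o ∂M.obsLaw
  have h1 : ∀ᵐ q ∂M.designLaw, ∀ᵐ y ∂(M.outcomeLaw q), M.trueDiff w π₀ π j (q, y) = C :=
    Measure.ae_ae_of_ae_compProd hconst
  -- A constant contrast with nonzero slope in the outcome would make `Y_j` constant given `(X, A)`,
  -- against the lower bound on its conditional variance.
  have h2 : ∀ᵐ q ∂M.designLaw, (π q.1).real {q.2} - (1 + w) * (π₀ q.1).real {q.2} = 0 := by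
    filter_upwards [h1, M.ae_designLaw_propensity hpos,
      M.measurePreserving_fst_designLaw.quasiMeasurePreserving.ae hvar] with q hq he hvq
    by_contra hne
    obtain ⟨b, hb⟩ := M.trueDiff_eq_affine w π₀ π j q
    have hep : M.propensity q.2 q.1 ≠ 0 := (hc.trans_le (he q.2)).ne'
    set s := ((π q.1).real {q.2} - (1 + w) * (π₀ q.1).real {q.2}) / M.propensity q.2 q.1 with hs
    have hs0 : s ≠ 0 := div_ne_zero hne hep
    have hy : (fun y : Fin d → unitInterval => (y j : ℝ)) =ᵐ[M.outcomeLaw q]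
        fun _ => (C - b) / s := by
      filter_upwards [hq] with y hy
      rw [hb] at hy
      rw [← hy]
      field_simp
      ring
    have hz : M.outcomeVar j q.2 q.1 = 0 := by
      unfold outcomeVar
      rw [variance_congr (μ := M.outcomeLaw (q.1, q.2)) hy, variance_eq_integral (by fun_prop)]
      simp
    have := hvq q.2
    rw [hz] at this
    linarith
  -- By positivity every treatment is an atom of `P_{A|X}`, so an identity for almost every
  -- treatment holds for all of them.
  have h3 : ∀ᵐ x ∂M.covariateLaw, ∀ k, (π x).real {k} = (1 + w) * (π₀ x).real {k} := by
    have h3' : ∀ᵐ x ∂M.covariateLaw, ∀ᵐ a ∂(M.treatmentLaw x),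
        (π x).real {a} - (1 + w) * (π₀ x).real {a} = 0 :=
      Measure.ae_ae_of_ae_compProd h2
    filter_upwards [h3', hpos] with x hx he k
    by_contra hne
    have hk : M.treatmentLaw x {k} = 0 := by
      refine measure_mono_null ?_ (ae_iff.1 hx)
      rintro _ rfl
      exact fun h => hne (sub_eq_zero.1 h)
    have := he k
    rw [propensity, measureReal_def, hk] at this
    simp only [ENNReal.toReal_zero] at this
    linarith
  -- Summing over `k`, both policies have total mass `1`, whence `1 = 1 + w`.
  have hw : w = 0 := by
    obtain ⟨x, hx⟩ := h3.exists
    have := sum_kernel_real π x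
    simp_rw [hx, ← Finset.mul_sum, sum_kernel_real] at this
    linarith
  refine ⟨hw, ?_⟩
  filter_upwards [h3] with x hx k
  rw [hx, hw]
  ring

end TrueDiff

end DataModel

/-! ### Cross-fitting -/

/-- Fubini over training coordinates `T` and held-out coordinates: a bound uniform in the training
data is a bound for the whole sample. -/
lemma pi_le_of_forall_slice_le {O : Type*} [MeasurableSpace O] (P : Measure O)
    [IsProbabilityMeasure P] {n : ℕ} (T : Finset (Fin n))
    {A : Set ((T → O) × ({i // i ∉ T} → O))} (hA : MeasurableSet A) {C : ℝ≥0∞}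
    (h : ∀ z, (Measure.pi fun _ : {i // i ∉ T} => P) {y | (z, y) ∈ A} ≤ C) :
    (Measure.pi fun _ : Fin n => P)
      {o | ((fun i : T => o i), fun i : {i // i ∉ T} => o i) ∈ A} ≤ C := by
  have hmp := measurePreserving_piEquivPiSubtypeProd (fun _ : Fin n => P) (· ∈ T)
  have h1 := hmp.measure_preimage hA.nullMeasurableSet
  refine (le_of_eq h1).trans ?_
  rw [Measure.prod_apply hA]
  refine (lintegral_mono fun z => h z).trans ?_
  simp

namespace DataModel

variable {𝒳 : Type*} [MeasurableSpace 𝒳] {K d : ℕ} (M : DataModel 𝒳 K d)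

lemma measurable_uncurry_onDesign {Z : Type*} [MeasurableSpace Z] {δ : Z → Fin K → 𝒳 → ℝ}
    (hδ : ∀ k, Measurable fun p : Z × 𝒳 => δ p.1 k p.2) :
    Measurable fun p : Z × (𝒳 × Fin K) => onDesign (δ p.1) p.2 := by
  have h : Measurable fun p : (Z × 𝒳) × Fin K => δ p.1.1 p.2 p.1.2 :=
    measurable_from_prod_countable_left fun k => hδ k
  exact h.comp (g := fun p : (Z × 𝒳) × Fin K => δ p.1.1 p.2 p.1.2)
    (f := fun p : Z × (𝒳 × Fin K) => ((p.1, p.2.1), p.2.2)) (by fun_prop)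

lemma measurable_eLpNorm_onDesign {Z : Type*} [MeasurableSpace Z] {δ : Z → Fin K → 𝒳 → ℝ}
    (hδ : ∀ k, Measurable fun p : Z × 𝒳 => δ p.1 k p.2) :
    Measurable fun z => eLpNorm (onDesign (δ z)) 2 M.designLaw := by
  simp_rw [eLpNorm_eq_lintegral_rpow_enorm_toReal (p := 2) (by simp) (by simp)]
  refine Measurable.pow_const ?_ _
  exact Measurable.lintegral_prod_right'
    (f := fun p : Z × (𝒳 × Fin K) => ‖onDesign (δ p.1) p.2‖ₑ ^ (2 : ℝ≥0∞).toReal)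
    ((measurable_uncurry_onDesign hδ).enorm.pow_const _)

variable {c : ℝ} (hc : 0 < c) (hpos : ∀ᵐ x ∂M.covariateLaw, ∀ k, c ≤ M.propensity k x)
  (π : Kernel 𝒳 (Fin K)) [IsMarkovKernel π]

/-- The error of a regression for outcome `j`. -/
def regError (m : Fin d → Fin K → 𝒳 → ℝ) (j : Fin d) (k : Fin K) (x : 𝒳) : ℝ :=
  m j k x - M.outcomeMean j k x

/-- The error of the policy score that is due to the estimation of the regression. -/
def scoreError (m : Fin d → Fin K → 𝒳 → ℝ) (j : Fin d) (o : Obs 𝒳 K d) : ℝ :=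
  M.policyScore m π j o - M.policyScore M.outcomeMean π j o

include hc hpos in
-- The regression is a fixed function here; the second moment is proportional to `ε ^ 2` with a
-- constant depending only on `K` and `c`. This uniformity is what survives conditioning on the
-- training data.
lemma scoreError_moments {m : Fin d → Fin K → 𝒳 → ℝ} {j : Fin d} (hm : ∀ k, Measurable (m j k))
    {ε : ℝ} (hε : 0 < ε)
    (h : eLpNorm (onDesign (M.regError m j)) 2 M.designLaw < ENNReal.ofReal ε) :
    MemLp (M.scoreError π m j) 2 M.obsLaw ∧ ∫ o, M.scoreError π m j o ∂M.obsLaw = 0 ∧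
      ∫ o, M.scoreError π m j o ^ 2 ∂M.obsLaw ≤ K * (1 + c⁻¹) ^ 2 * c⁻¹ * ε ^ 2 := by
  have hδm : ∀ k, Measurable (M.regError m j k) := fun k =>
    (hm k).sub (M.measurable_outcomeMean j k)
  have hdm : Measurable (onDesign (M.regError m j)) :=
    measurable_from_prod_countable_left fun k => hδm k
  have hδ : MemLp (onDesign (M.regError m j)) 2 M.designLaw :=
    ⟨hdm.aestronglyMeasurable, h.trans ENNReal.ofReal_lt_top⟩
  have hmp := M.measurePreserving_fst_obsLaw
  have heq : M.scoreError π m j = M.scoreShift π (M.regError m j) ∘ Prod.fst := by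
    ext o
    exact M.policyScore_sub_policyScore m M.outcomeMean π j o
  obtain ⟨hL, hle⟩ := M.integral_sq_scoreShift hc hpos π hδm hδ
  have hsm := M.measurable_scoreShift π hδm
  refine ⟨heq ▸ hL.comp_measurePreserving hmp, ?_, ?_⟩
  · rw [heq]
    have := integral_map (μ := M.obsLaw) hmp.measurable.aemeasurable
      (f := M.scoreShift π (M.regError m j)) hsm.aestronglyMeasurable
    rw [hmp.map_eq, M.integral_scoreShift hc hpos π (hL.integrable one_le_two)] at this
    exact this.symm
  · rw [heq]
    have := integral_map (μ := M.obsLaw) hmp.measurable.aemeasurable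
      (f := fun q => M.scoreShift π (M.regError m j) q ^ 2) (hsm.pow_const 2).aestronglyMeasurable
    rw [hmp.map_eq] at this
    refine (le_of_eq this.symm).trans (hle.trans ?_)
    gcongr
    have h2 : eLpNorm (onDesign (M.regError m j)) 2 M.designLaw ^ 2 =
        ENNReal.ofReal (∫ q, onDesign (M.regError m j) q ^ 2 ∂M.designLaw) := by
      rw [hδ.eLpNorm_eq_integral_rpow_norm (by simp) (by simp), ← ENNReal.ofReal_pow (by positivity)]
      congr 1
      simp only [ENNReal.toReal_ofNat, Real.rpow_ofNat, Real.norm_eq_abs, sq_abs]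
      exact Real.rpow_inv_natCast_pow (integral_nonneg fun q => sq_nonneg _) two_ne_zero
    have h3 := pow_le_pow_left' h.le 2
    rw [h2, ← ENNReal.ofReal_pow hε.le] at h3
    exact (ENNReal.ofReal_le_ofReal_iff (by positivity)).1 h3

end DataModel

namespace CrossFit

variable {𝒳 : Type*} [MeasurableSpace 𝒳] {K d F : ℕ} {𝒰 : Type*} [MeasurableSpace 𝒰]
  (C : CrossFit 𝒳 K d F 𝒰) (M : DataModel 𝒳 K d)

instance (n : ℕ) : IsProbabilityMeasure (C.sampleLaw M n) := by
  unfold sampleLaw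
  infer_instance

lemma measurePreserving_fst_sampleLaw (n : ℕ) : MeasurePreserving Prod.fst (C.sampleLaw M n)
    (Measure.pi fun _ : Fin n => M.obsLaw) :=
  measurePreserving_fst

variable {n : ℕ}

/-- There are only finitely many fold assignments, so measurability may be checked with the
assignment frozen; the training set, on which the type of the learner's input depends, is then
fixed. -/
lemma measurable_comp_fold {β Z : Type*} [MeasurableSpace β] [MeasurableSpace Z]
    {f : (Fin n → Fin F) → Z → β} (hf : ∀ φ, Measurable (f φ)) {u : Z → 𝒰} (hu : Measurable u) :
    Measurable fun z => f (C.fold n (u z)) z := by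
  have h : Measurable fun p : (Fin n → Fin F) × Z => f p.1 p.2 :=
    measurable_from_prod_countable_right hf
  exact h.comp (((C.measurable_fold n).comp hu).prodMk measurable_id)

lemma measurable_muHat (l : Fin F) (j : Fin d) (k : Fin K) :
    Measurable fun p : ((Fin n → Obs 𝒳 K d) × 𝒰) × 𝒳 => C.muHat p.1 l j k p.2 := by
  unfold muHat
  refine C.measurable_comp_fold
    (f := fun φ (p : ((Fin n → Obs 𝒳 K d) × 𝒰) × 𝒳) =>
      C.learner n l {i | φ i ≠ l} (fun i => p.1.1 i) p.1.2 j k p.2)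
    (fun φ => ?_) (u := fun p => p.1.2) (by fun_prop)
  refine (C.measurable_learner n l {i | φ i ≠ l} j k).comp
    (f := fun p : ((Fin n → Obs 𝒳 K d) × 𝒰) × 𝒳 =>
      (((fun i : ({i | φ i ≠ l} : Finset (Fin n)) => p.1.1 i), p.1.2), p.2)) ?_
  fun_prop

lemma measurable_fittedScore (π : Kernel 𝒳 (Fin K)) (j : Fin d) (i : Fin n) :
    Measurable fun ω : (Fin n → Obs 𝒳 K d) × 𝒰 => C.fittedScore M ω π j i := by
  unfold fittedScore
  refine C.measurable_comp_fold
    (f := fun φ (ω : (Fin n → Obs 𝒳 K d) × 𝒰) => M.policyScore (C.muHat ω (φ i)) π j (ω.1 i))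
    (fun φ => ?_) (u := fun ω => ω.2) (by fun_prop)
  have h1 := M.measurable_policyScore (j := j)
    (m := fun ω : (Fin n → Obs 𝒳 K d) × 𝒰 => C.muHat ω (φ i))
    (fun k => C.measurable_muHat (φ i) j k) π
  have h2 : Measurable fun ω : (Fin n → Obs 𝒳 K d) × 𝒰 => (ω, ω.1 i) := by fun_prop
  have h3 := h1.comp h2
  simp only [Function.comp_def] at h3
  exact h3

lemma _root_.SafePolicy.DataModel.measurable_regError {Z : Type*} [MeasurableSpace Z]
    {m : Z → Fin d → Fin K → 𝒳 → ℝ} {j : Fin d}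
    (hm : ∀ k, Measurable fun p : Z × 𝒳 => m p.1 j k p.2) (k : Fin K) :
    Measurable fun p : Z × 𝒳 => M.regError (m p.1) j k p.2 :=
  (hm k).sub ((M.measurable_outcomeMean j k).comp measurable_snd)

section FoldSums

variable {c : ℝ} (hc : 0 < c) (hpos : ∀ᵐ x ∂M.covariateLaw, ∀ k, c ≤ M.propensity k x)
  (π : Kernel 𝒳 (Fin K)) [IsMarkovKernel π]

/-- The sum over the `l`-th fold of a function of the score errors. -/
def foldSum (h : ℝ → ℝ) (l : Fin F) (j : Fin d) (ω : (Fin n → Obs 𝒳 K d) × 𝒰) : ℝ :=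
  ∑ i, if C.fold n ω.2 i = l then h (M.scoreError π (C.muHat ω l) j (ω.1 i)) else 0

omit [IsMarkovKernel π] in
lemma measurable_foldSum {h : ℝ → ℝ} (hh : Measurable h) (l : Fin F) (j : Fin d) :
    Measurable fun ω : (Fin n → Obs 𝒳 K d) × 𝒰 => C.foldSum M π h l j ω := by
  unfold foldSum DataModel.scoreError
  refine Finset.measurable_sum _ fun i _ => ?_
  refine C.measurable_comp_fold
    (f := fun φ (ω : (Fin n → Obs 𝒳 K d) × 𝒰) => if φ i = l then
      h (M.policyScore (C.muHat ω l) π j (ω.1 i) - M.policyScore M.outcomeMean π j (ω.1 i)) else 0)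
    (fun φ => ?_) (u := fun ω => ω.2) (by fun_prop)
  split_ifs
  · have h1 := M.measurable_policyScore (j := j)
      (m := fun ω : (Fin n → Obs 𝒳 K d) × 𝒰 => C.muHat ω l)
      (fun k => C.measurable_muHat l j k) π
    have h2 : Measurable fun ω : (Fin n → Obs 𝒳 K d) × 𝒰 => (ω, ω.1 i) := by fun_prop
    have h3 := h1.comp h2
    simp only [Function.comp_def] at h3
    exact hh.comp (h3.sub ((M.measurable_trueScore π j).comp (by fun_prop)))
  · exact measurable_const

omit [IsMarkovKernel π] in
/-- Conditionally on the seed and the observations outside a fold, the regression is a constant,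
so that a bound for fixed regressions carries over. -/
lemma sampleLaw_foldSum_le {h : ℝ → ℝ} (hh : Measurable h) (l : Fin F) (j : Fin d) {ε η : ℝ}
    {B : ℝ≥0∞}
    (hB : ∀ (T : Finset (Fin n)) (m : Fin d → Fin K → 𝒳 → ℝ), (∀ k, Measurable (m j k)) →
      eLpNorm (DataModel.onDesign (M.regError m j)) 2 M.designLaw < ENNReal.ofReal ε →
      (Measure.pi fun _ : {i // i ∉ T} => M.obsLaw)
        {y | η ≤ |∑ i, h (M.scoreError π m j (y i))|} ≤ B) :
    C.sampleLaw M n {ω |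
      eLpNorm (DataModel.onDesign (M.regError (C.muHat ω l) j)) 2 M.designLaw < ENNReal.ofReal ε ∧
      η ≤ |C.foldSum M π h l j ω|} ≤ B := by
  have hE : MeasurableSet {ω : (Fin n → Obs 𝒳 K d) × 𝒰 |
      eLpNorm (DataModel.onDesign (M.regError (C.muHat ω l) j)) 2 M.designLaw < ENNReal.ofReal ε ∧
      η ≤ |C.foldSum M π h l j ω|} := by
    exact (measurableSet_lt (M.measurable_eLpNorm_onDesign
        (δ := fun ω : (Fin n → Obs 𝒳 K d) × 𝒰 => M.regError (C.muHat ω l) j)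
        (M.measurable_regError (m := fun ω : (Fin n → Obs 𝒳 K d) × 𝒰 => C.muHat ω l)
          fun k => C.measurable_muHat l j k)) measurable_const).inter
      (measurableSet_le measurable_const (C.measurable_foldSum M π hh l j).abs)
  unfold sampleLaw
  -- Fixing the seed first makes the split, and hence the training set `T`, deterministic.
  rw [Measure.prod_apply_symm hE]
  refine (lintegral_mono (g := fun _ => B) fun u => ?_).trans (by simp)
  set T : Finset (Fin n) := {i | C.fold n u i ≠ l} with hT
  set m : (T → Obs 𝒳 K d) → Fin d → Fin K → 𝒳 → ℝ := fun z => C.learner n l T z u with hm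
  have hmm : ∀ k, Measurable fun p : (T → Obs 𝒳 K d) × 𝒳 => m p.1 j k p.2 := fun k =>
    (C.measurable_learner n l T j k).comp
      (f := fun p : (T → Obs 𝒳 K d) × 𝒳 => ((p.1, u), p.2)) (by fun_prop)
  set A : Set ((T → Obs 𝒳 K d) × ({i // i ∉ T} → Obs 𝒳 K d)) := {p |
    eLpNorm (DataModel.onDesign (M.regError (m p.1) j)) 2 M.designLaw < ENNReal.ofReal ε ∧
      η ≤ |∑ i, h (M.scoreError π (m p.1) j (p.2 i))|} with hA
  have hsum : Measurable fun p : (T → Obs 𝒳 K d) × ({i // i ∉ T} → Obs 𝒳 K d) =>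
      ∑ i, h (M.scoreError π (m p.1) j (p.2 i)) := by
    refine Finset.measurable_sum _ fun i _ => hh.comp ?_
    have h1 := M.measurable_policyScore (j := j) (m := m) hmm π
    have h2 : Measurable fun p : (T → Obs 𝒳 K d) × ({i // i ∉ T} → Obs 𝒳 K d) =>
      (p.1, p.2 i) := by fun_prop
    have h3 := h1.comp h2
    simp only [Function.comp_def] at h3
    exact h3.sub ((M.measurable_trueScore π j).comp (by fun_prop))
  have hAm : MeasurableSet A :=
    (measurableSet_lt ((M.measurable_eLpNorm_onDesign
        (δ := fun z : T → Obs 𝒳 K d => M.regError (m z) j) (M.measurable_regError hmm)).comp measurable_fst)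
        measurable_const).inter (measurableSet_le measurable_const hsum.abs)
  have hslice := pi_le_of_forall_slice_le M.obsLaw T hAm (C := B) fun z => by
    by_cases hz : eLpNorm (DataModel.onDesign (M.regError (m z) j)) 2 M.designLaw <
        ENNReal.ofReal ε
    · refine le_trans (measure_mono fun y hy => hy.2) (hB T (m z) (fun k => ?_) hz)
      exact (hmm k).comp (f := fun x => (z, x)) (by fun_prop)
    · have : {y | (z, y) ∈ A} = ∅ := by
        ext y
        simp [hA, hz]
      simp [this]
  refine (measure_mono fun o ho => ?_).trans hslice
  refine ⟨ho.1, ho.2.trans_eq ?_⟩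
  congr 1
  simp only [foldSum]
  rw [← Finset.sum_filter]
  refine Finset.sum_subtype _ (fun i => ?_) _
  simp [hT]

omit [IsMarkovKernel π] in
-- The event splits according to whether the `L²` error of the regression is at least `ε`.
-- Consistency handles the first part; on the second, `hB` supplies a bound of order `ε ^ 2` whose
-- constant does not depend on `ε`, `n` or the training set, so `ε` can be chosen once and for all.
lemma vanishes_foldSum (l : Fin F) {j : Fin d}
    (hcons : ∀ ε : ℝ≥0∞, 0 < ε → Tendsto (fun n => C.sampleLaw M n {ω | ε ≤
      eLpNorm (fun q : 𝒳 × Fin K => C.muHat ω l j q.2 q.1 - M.outcomeMean j q.2 q.1)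
        2 M.designLaw}) atTop (𝓝 0))
    {h : ℕ → ℝ → ℝ} (hh : ∀ n, Measurable (h n))
    (hB : ∀ η : ℝ, 0 < η → ∃ b : ℝ, ∀ ε : ℝ, 0 < ε → ∀ n : ℕ, 0 < n → ∀ (T : Finset (Fin n))
      (m : Fin d → Fin K → 𝒳 → ℝ), (∀ k, Measurable (m j k)) →
      eLpNorm (DataModel.onDesign (M.regError m j)) 2 M.designLaw < ENNReal.ofReal ε →
      (Measure.pi fun _ : {i // i ∉ T} => M.obsLaw)
        {y | η ≤ |∑ i, h n (M.scoreError π m j (y i))|} ≤ ENNReal.ofReal (b * ε ^ 2)) :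
    VanishesInProb (C.sampleLaw M) fun n ω => C.foldSum M π (h n) l j ω := by
  intro η hη
  obtain ⟨b, hb⟩ := hB η hη
  rw [ENNReal.tendsto_nhds_zero]
  intro ε' hε'
  have hε2 : 0 < ε' / 2 := ENNReal.div_pos hε'.ne' (by simp)
  have hlim : Tendsto (fun ε : ℝ => ENNReal.ofReal (b * ε ^ 2)) (𝓝[>] 0) (𝓝 0) := by
    have : Tendsto (fun ε : ℝ => ENNReal.ofReal (b * ε ^ 2)) (𝓝 0)
        (𝓝 (ENNReal.ofReal (b * 0 ^ 2))) :=
      (ENNReal.continuous_ofReal.comp (by fun_prop)).tendsto _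
    simpa using this.mono_left nhdsWithin_le_nhds
  obtain ⟨ε, hεb, hε⟩ :=
    (((ENNReal.tendsto_nhds_zero.1 hlim) (ε' / 2) hε2).and self_mem_nhdsWithin).exists
  have hε : (0 : ℝ) < ε := hε
  filter_upwards [(ENNReal.tendsto_nhds_zero.1 (hcons (ENNReal.ofReal ε)
    (ENNReal.ofReal_pos.2 hε))) (ε' / 2) hε2, eventually_gt_atTop 0] with n hn hn0
  have h1 := C.sampleLaw_foldSum_le M π (hh n) l j (ε := ε) (η := η) (hb ε hε n hn0)
  rw [← ENNReal.add_halves ε']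
  refine le_trans ?_ (add_le_add hn (h1.trans hεb))
  refine (measure_mono fun ω hω => ?_).trans (measure_union_le _ _)
  by_cases hlt : eLpNorm (DataModel.onDesign (M.regError (C.muHat ω l) j)) 2 M.designLaw <
      ENNReal.ofReal ε
  · exact Or.inr ⟨hlt, hω⟩
  · exact Or.inl (not_lt.1 hlt)

include hc hpos in
-- Chebyshev: the held-out errors are independent and centred, at most `n` in number, so after
-- scaling by `1 / √n` the variance of their sum is at most a constant times `ε ^ 2`.
lemma vanishes_foldSum_sqrt (l : Fin F) {j : Fin d}
    (hcons : ∀ ε : ℝ≥0∞, 0 < ε → Tendsto (fun n => C.sampleLaw M n {ω | ε ≤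
      eLpNorm (fun q : 𝒳 × Fin K => C.muHat ω l j q.2 q.1 - M.outcomeMean j q.2 q.1)
        2 M.designLaw}) atTop (𝓝 0)) :
    VanishesInProb (C.sampleLaw M) fun n ω => C.foldSum M π (fun x => (√n)⁻¹ * x) l j ω := by
  refine C.vanishes_foldSum M π l hcons (h := fun n x => (√n)⁻¹ * x) (fun n => by fun_prop)
    fun η hη => ⟨K * (1 + c⁻¹) ^ 2 * c⁻¹ / η ^ 2, fun ε hε n hn T m hm hlt => ?_⟩
  obtain ⟨hL, h0, h2⟩ := M.scoreError_moments hc hpos π hm hε hlt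
  have hn' : (0 : ℝ) < n := by exact_mod_cast hn
  have hs : 0 < √(n : ℝ) := Real.sqrt_pos.2 hn'
  have hcheb := pi_meas_ge_le_variance (κ := {i // i ∉ T}) M.obsLaw hL (η := η * √n)
    (by positivity)
  rw [h0] at hcheb
  refine (measure_mono fun y hy => ?_).trans (hcheb.trans (ENNReal.ofReal_le_ofReal ?_))
  · simp only [Set.mem_ofPred_eq, ← Finset.mul_sum, abs_mul, abs_inv, abs_of_pos hs] at hy
    simp only [Set.mem_ofPred_eq, mul_zero, sub_zero]
    rwa [inv_mul_eq_div, le_div_iff₀ hs] at hy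
  · have hcard : (Fintype.card {i // i ∉ T} : ℝ) ≤ n := by
      exact_mod_cast (Fintype.card_subtype_le _).trans_eq (Fintype.card_fin n)
    have hvar : Var[M.scoreError π m j; M.obsLaw] ≤ K * (1 + c⁻¹) ^ 2 * c⁻¹ * ε ^ 2 :=
      (variance_le_expectation_sq hL.1).trans h2
    rw [mul_pow, Real.sq_sqrt hn'.le]
    calc _ ≤ (n : ℝ) * (K * (1 + c⁻¹) ^ 2 * c⁻¹ * ε ^ 2) / (η ^ 2 * n) := by
          gcongr
          exact variance_nonneg _ _
      _ = _ := by field_simp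

include hc hpos in
-- Markov's inequality for the mean of squares; only the second moment of the errors is used.
lemma vanishes_foldSum_sq (l : Fin F) {j : Fin d}
    (hcons : ∀ ε : ℝ≥0∞, 0 < ε → Tendsto (fun n => C.sampleLaw M n {ω | ε ≤
      eLpNorm (fun q : 𝒳 × Fin K => C.muHat ω l j q.2 q.1 - M.outcomeMean j q.2 q.1)
        2 M.designLaw}) atTop (𝓝 0)) :
    VanishesInProb (C.sampleLaw M) fun n ω => C.foldSum M π (fun x => (n : ℝ)⁻¹ * x ^ 2) l j ω := by
  refine C.vanishes_foldSum M π l hcons (h := fun n x => (n : ℝ)⁻¹ * x ^ 2) (fun n => by fun_prop)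
    fun η hη => ⟨K * (1 + c⁻¹) ^ 2 * c⁻¹ / η, fun ε hε n hn T m hm hlt => ?_⟩
  obtain ⟨hL, h0, h2⟩ := M.scoreError_moments hc hpos π hm hε hlt
  have hn' : (0 : ℝ) < n := by exact_mod_cast hn
  set Q := Measure.pi fun _ : {i // i ∉ T} => M.obsLaw with hQ
  have hint : Integrable (fun y : {i // i ∉ T} → Obs 𝒳 K d =>
      ∑ i, M.scoreError π m j (y i) ^ 2) Q :=
    integrable_finsetSum _ fun i _ =>
      integrable_comp_eval (μ := fun _ : {i // i ∉ T} => M.obsLaw) hL.integrable_sq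
  have hmk := mul_meas_ge_le_integral_of_nonneg (Eventually.of_forall fun y =>
    Finset.sum_nonneg fun i _ => sq_nonneg (M.scoreError π m j (y i))) hint (η * n)
  have hcard : (Fintype.card {i // i ∉ T} : ℝ) ≤ n := by
    exact_mod_cast (Fintype.card_subtype_le _).trans_eq (Fintype.card_fin n)
  rw [hQ, integral_sum_pi (κ := {i // i ∉ T}) M.obsLaw
    (g := fun o => M.scoreError π m j o ^ 2) hL.integrable_sq, ← hQ] at hmk
  have hmk2 : Q.real {y | η * n ≤ ∑ i, M.scoreError π m j (y i) ^ 2} ≤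
      K * (1 + c⁻¹) ^ 2 * c⁻¹ / η * ε ^ 2 := by
    have h3 : (η * n) * Q.real {y | η * n ≤ ∑ i, M.scoreError π m j (y i) ^ 2} ≤
        n * (K * (1 + c⁻¹) ^ 2 * c⁻¹ * ε ^ 2) := by
      refine hmk.trans ?_
      gcongr
    rw [← mul_le_mul_iff_right₀ (show 0 < η * n by positivity)]
    refine h3.trans_eq ?_
    field_simp
  refine (measure_mono (t := {y | η * n ≤ ∑ i, M.scoreError π m j (y i) ^ 2})
    fun y hy => ?_).trans ?_
  · simp only [Set.mem_ofPred_eq, ← Finset.mul_sum] at hy ⊢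
    rw [abs_of_nonneg (mul_nonneg (by positivity) (Finset.sum_nonneg fun i _ => sq_nonneg _)),
      inv_mul_eq_div, le_div_iff₀ hn'] at hy
    exact hy
  · rw [← ofReal_measureReal]
    exact ENNReal.ofReal_le_ofReal hmk2

end FoldSums

end CrossFit

/-! ### Consistency of the empirical covariance matrix -/

lemma abs_mean_mul_le {n : ℕ} (x y : Fin n → ℝ) :
    |(∑ i, x i * y i) / n| ≤ √((∑ i, x i ^ 2) / n) * √((∑ i, y i ^ 2) / n) := by
  rw [abs_div, Nat.abs_cast, Real.sqrt_div' _ (Nat.cast_nonneg n),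
    Real.sqrt_div' _ (Nat.cast_nonneg n), div_mul_div_comm, Real.mul_self_sqrt (Nat.cast_nonneg n)]
  gcongr
  calc |∑ i, x i * y i| ≤ ∑ i, |x i| * |y i| := by
        refine (Finset.abs_sum_le_sum_abs _ _).trans_eq ?_
        simp only [abs_mul]
    _ ≤ √(∑ i, |x i| ^ 2) * √(∑ i, |y i| ^ 2) := Real.sum_mul_le_sqrt_mul_sqrt _ _ _
    _ = _ := by simp only [sq_abs]

lemma abs_mean_le {n : ℕ} (x : Fin n → ℝ) : |(∑ i, x i) / n| ≤ √((∑ i, x i ^ 2) / n) := by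
  rcases Nat.eq_zero_or_pos n with rfl | hn
  · simp
  have hn' : (n : ℝ) ≠ 0 := by positivity
  simpa [hn'] using abs_mean_mul_le x fun _ => 1

/-- Here `u` stands for the bounded centred true scores and `r` for the estimation errors. Expanding
the covariance leaves the mean of `u * u'` plus terms which Cauchy–Schwarz bounds by the root mean
squares of `r` and `r'` and by the means of `u` and `u'`, all of which vanish in probability in the
application. -/
lemma abs_empiricalCov_sub_le {n : ℕ} (hn : 0 < n) {B s : ℝ} (hB : 0 ≤ B)
    (u r u' r' : Fin n → ℝ)
    (hu : ∀ i, |u i| ≤ B) (hu' : ∀ i, |u' i| ≤ B) :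
    |(∑ i, (u i + r i - (∑ i, (u i + r i)) / n) * (u' i + r' i - (∑ i, (u' i + r' i)) / n)) / n - s| ≤
      |(∑ i, u i * u' i) / n - s| + B * √((∑ i, r' i ^ 2) / n) + B * √((∑ i, r i ^ 2) / n) +
        √((∑ i, r i ^ 2) / n) * √((∑ i, r' i ^ 2) / n) +
        (|(∑ i, u i) / n| + √((∑ i, r i ^ 2) / n)) *
          (|(∑ i, u' i) / n| + √((∑ i, r' i ^ 2) / n)) := by
  have hn' : (0 : ℝ) < n := by exact_mod_cast hn
  have hsq : ∀ x : Fin n → ℝ, (∀ i, |x i| ≤ B) → √((∑ i, x i ^ 2) / n) ≤ B := fun x hx => by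
    refine Real.sqrt_le_iff.2 ⟨hB, (div_le_iff₀ hn').2 ?_⟩
    calc ∑ i, x i ^ 2 ≤ ∑ _i : Fin n, B ^ 2 := Finset.sum_le_sum fun i _ => sq_le_sq.2
          ((hx i).trans (le_abs_self B))
      _ = B ^ 2 * n := by simp [mul_comm]
  set D := (∑ i, (u i + r i)) / n with hD
  set D' := (∑ i, (u' i + r' i)) / n with hD'
  have hsum : ∑ i, (u i + r i) = n * D := by rw [hD]; field_simp
  have hsum' : ∑ i, (u' i + r' i) = n * D' := by rw [hD']; field_simp
  have hexp : (∑ i, (u i + r i - D) * (u' i + r' i - D')) / n =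
      (∑ i, u i * u' i) / n + (∑ i, u i * r' i) / n + (∑ i, r i * u' i) / n +
        (∑ i, r i * r' i) / n - D * D' := by
    have h1 : ∀ i, (u i + r i - D) * (u' i + r' i - D') = u i * u' i + u i * r' i + r i * u' i +
        r i * r' i - (u i + r i) * D' - D * (u' i + r' i) + D * D' := fun i => by ring
    simp_rw [h1, Finset.sum_add_distrib, Finset.sum_sub_distrib, Finset.sum_add_distrib,
      ← Finset.sum_mul, ← Finset.mul_sum, ← Finset.sum_add_distrib]
    rw [hsum, hsum']
    simp only [Finset.sum_const, Finset.card_univ, Fintype.card_fin, nsmul_eq_mul,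
      Finset.sum_add_distrib]
    field_simp
    ring
  have hDle : |D| ≤ |(∑ i, u i) / n| + √((∑ i, r i ^ 2) / n) := by
    rw [hD, Finset.sum_add_distrib, add_div]
    exact (abs_add_le _ _).trans (add_le_add le_rfl (abs_mean_le r))
  have hDle' : |D'| ≤ |(∑ i, u' i) / n| + √((∑ i, r' i ^ 2) / n) := by
    rw [hD', Finset.sum_add_distrib, add_div]
    exact (abs_add_le _ _).trans (add_le_add le_rfl (abs_mean_le r'))
  have h1 : |(∑ i, u i * r' i) / n| ≤ B * √((∑ i, r' i ^ 2) / n) :=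
    (abs_mean_mul_le u r').trans (by gcongr; exact hsq u hu)
  have h2 : |(∑ i, r i * u' i) / n| ≤ B * √((∑ i, r i ^ 2) / n) :=
    (abs_mean_mul_le r u').trans (by rw [mul_comm]; gcongr; exact hsq u' hu')
  have h3 := abs_mean_mul_le r r'
  have h4 : |D * D'| ≤ (|(∑ i, u i) / n| + √((∑ i, r i ^ 2) / n)) *
      (|(∑ i, u' i) / n| + √((∑ i, r' i ^ 2) / n)) := by
    rw [abs_mul]
    gcongr
  rw [hexp]
  have h5 : ∀ a b c e f : ℝ, |a + b + c + e - f - s| ≤ |a - s| + |b| + |c| + |e| + |f| := by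
    intro a b c e f
    rw [show a + b + c + e - f - s = (a - s) + b + c + e + -f by ring, ← abs_neg f]
    refine (abs_add_le _ _).trans (add_le_add ?_ le_rfl)
    refine (abs_add_le _ _).trans (add_le_add ?_ le_rfl)
    refine (abs_add_le _ _).trans (add_le_add ?_ le_rfl)
    exact abs_add_le _ _
  refine (h5 _ _ _ _ _).trans ?_
  gcongr

namespace CrossFit

variable {𝒳 : Type*} [MeasurableSpace 𝒳] {K d F : ℕ} {𝒰 : Type*} [MeasurableSpace 𝒰]
  (C : CrossFit 𝒳 K d F 𝒰) (M : DataModel 𝒳 K d)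

lemma vanishes_of_pi {f : ∀ n, (Fin n → Obs 𝒳 K d) → ℝ}
    (hf : ∀ ε : ℝ, 0 < ε → Tendsto (fun n => (Measure.pi fun _ : Fin n => M.obsLaw)
      {o | ε ≤ |f n o|}) atTop (𝓝 0)) :
    VanishesInProb (C.sampleLaw M) fun n ω => f n ω.1 := fun ε hε => by
  refine (hf ε hε).congr fun n => ?_
  have : {ω : (Fin n → Obs 𝒳 K d) × 𝒰 | ε ≤ |f n ω.1|} = {o | ε ≤ |f n o|} ×ˢ Set.univ := by
    ext ω
    simp
  rw [this, sampleLaw, Measure.prod_prod]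
  simp

lemma ae_sampleLaw_forall {p : Obs 𝒳 K d → Prop} (hp : ∀ᵐ o ∂M.obsLaw, p o) (n : ℕ) :
    ∀ᵐ ω ∂(C.sampleLaw M n), ∀ i, p (ω.1 i) := by
  rw [ae_all_iff]
  intro i
  have h1 : ∀ᵐ o ∂(Measure.pi fun _ : Fin n => M.obsLaw), p (o i) :=
    (measurePreserving_eval (fun _ : Fin n => M.obsLaw) i).quasiMeasurePreserving.ae hp
  exact (C.measurePreserving_fst_sampleLaw M n).quasiMeasurePreserving.ae h1

/-- The consistency in `L²(P)` of the estimated regressions for outcome `j`. -/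
def IsConsistent (j : Fin d) : Prop :=
  ∀ (l : Fin F) (ε : ℝ≥0∞), 0 < ε → Tendsto (fun n => C.sampleLaw M n {ω | ε ≤
      eLpNorm (fun q : 𝒳 × Fin K => C.muHat ω l j q.2 q.1 - M.outcomeMean j q.2 q.1)
        2 M.designLaw}) atTop (𝓝 0)

/-- The estimation error of the score of the `i`-th observation. -/
def scoreRem {n : ℕ} (ω : (Fin n → Obs 𝒳 K d) × 𝒰) (π : Kernel 𝒳 (Fin K)) (j : Fin d)
    (i : Fin n) : ℝ :=
  C.fittedScore M ω π j i - M.policyScore M.outcomeMean π j (ω.1 i)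

lemma sum_foldSum {n : ℕ} (ω : (Fin n → Obs 𝒳 K d) × 𝒰) (π : Kernel 𝒳 (Fin K)) (j : Fin d)
    (h : ℝ → ℝ) : ∑ i, h (C.scoreRem M ω π j i) = ∑ l, C.foldSum M π h l j ω := by
  unfold foldSum
  rw [Finset.sum_comm]
  refine Finset.sum_congr rfl fun i _ => ?_
  simp only [Finset.sum_ite_eq, Finset.mem_univ, if_true]
  rfl

section Vanish

variable {c : ℝ} (hc : 0 < c) (hpos : ∀ᵐ x ∂M.covariateLaw, ∀ k, c ≤ M.propensity k x)

include hc hpos in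
lemma vanishes_sum_scoreRem (π : Kernel 𝒳 (Fin K)) [IsMarkovKernel π] {j : Fin d}
    (hcons : C.IsConsistent M j) :
    VanishesInProb (C.sampleLaw M) fun n ω => (√n)⁻¹ * ∑ i, C.scoreRem M ω π j i := by
  have := VanishesInProb.sum (s := Finset.univ)
    fun l _ => C.vanishes_foldSum_sqrt M hc hpos π l (hcons l)
  simp_rw [← C.sum_foldSum M _ π j] at this
  simp_rw [Finset.mul_sum]
  exact this

include hc hpos in
lemma vanishes_sum_scoreRem_sq (π : Kernel 𝒳 (Fin K)) [IsMarkovKernel π] {j : Fin d}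
    (hcons : C.IsConsistent M j) :
    VanishesInProb (C.sampleLaw M) fun n ω => (∑ i, C.scoreRem M ω π j i ^ 2) / n := by
  have := VanishesInProb.sum (s := Finset.univ)
    fun l _ => C.vanishes_foldSum_sq M hc hpos π l (hcons l)
  simp_rw [← C.sum_foldSum M _ π j] at this
  simp_rw [← inv_mul_eq_div, Finset.mul_sum]
  exact this

variable (w : ℝ) (π₀ π : Kernel 𝒳 (Fin K)) [IsMarkovKernel π₀] [IsMarkovKernel π] {j : Fin d}

/-- The estimation error of the contrast of the scores of the `i`-th observation. -/
def diffRem {n : ℕ} (ω : (Fin n → Obs 𝒳 K d) × 𝒰) (j : Fin d) (i : Fin n) : ℝ :=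
  C.scoreRem M ω π j i - (1 + w) * C.scoreRem M ω π₀ j i

include hc hpos in
lemma vanishes_sum_diffRem (hcons : C.IsConsistent M j) :
    VanishesInProb (C.sampleLaw M) fun n ω => (√n)⁻¹ * ∑ i, C.diffRem M w π₀ π ω j i := by
  have h := (C.vanishes_sum_scoreRem M hc hpos π hcons).add
    ((C.vanishes_sum_scoreRem M hc hpos π₀ hcons).const_mul (-(1 + w)))
  refine h.mono (Eventually.of_forall fun n => Eventually.of_forall fun ω => le_of_eq ?_)
  simp only [diffRem, Finset.sum_sub_distrib, ← Finset.mul_sum]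
  congr 1
  ring

include hc hpos in
lemma vanishes_sum_diffRem_sq (hcons : C.IsConsistent M j) :
    VanishesInProb (C.sampleLaw M) fun n ω => (∑ i, C.diffRem M w π₀ π ω j i ^ 2) / n := by
  have h := ((C.vanishes_sum_scoreRem_sq M hc hpos π hcons).const_mul 2).add
    ((C.vanishes_sum_scoreRem_sq M hc hpos π₀ hcons).const_mul (2 * (1 + w) ^ 2))
  refine h.mono (Eventually.of_forall fun n => Eventually.of_forall fun ω => ?_)
  refine abs_le_abs_of_nonneg (by positivity) ?_
  rw [← mul_div_assoc, ← mul_div_assoc, ← add_div, Finset.mul_sum, Finset.mul_sum,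
    ← Finset.sum_add_distrib]
  gcongr with i
  unfold diffRem
  -- The inequality `(x - y) ^ 2 ≤ 2 x ^ 2 + 2 y ^ 2`, with the square of `x + y` as its slack.
  nlinarith [sq_nonneg (C.scoreRem M ω π j i + (1 + w) * C.scoreRem M ω π₀ j i)]

end Vanish

end CrossFit

/-! ### The miss probability given the data -/

/-- When `σ a = 0` the bound does not involve the quantile, and the coordinate misses always or
never. For the other coordinates a miss means that one common quantile exceeds `s * δ a / σ a`, so
their union is governed by the smallest of these thresholds. -/
lemma exists_tendsto_pi_miss {E ι : Type*} [MeasurableSpace E] [Finite ι] (ν : Measure E)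
    [IsProbabilityMeasure ν] {α : ℝ} (hα : α ∈ Set.Ioo (0 : ℝ) 1) {f : E → ℝ} (hf : Measurable f)
    (δ σ : ι → ℝ) (hσ : ∀ a, 0 ≤ σ a) {s : ℝ} (hs : 0 < s) :
    ∃ L : ℝ≥0∞, Tendsto (fun m : ℕ => (Measure.pi fun _ : Fin m => ν)
      {ρ | ∃ a, δ a < empiricalQuantile α (fun i => f (ρ i)) / s * σ a}) atTop (𝓝 L) ∧
      (L ≠ 0 → (∃ a, σ a = 0 ∧ δ a < 0) ∨
        ∃ a, σ a ≠ 0 ∧ ν {x | f x ≤ s * δ a / σ a} ≤ ENNReal.ofReal α) := by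
  by_cases hdeg : ∃ a, σ a = 0 ∧ δ a < 0
  · obtain ⟨a, ha, hδ⟩ := hdeg
    refine ⟨1, tendsto_const_nhds.congr fun m => ?_, fun _ => Or.inl ⟨a, ha, hδ⟩⟩
    have : {ρ : Fin m → E | ∃ a, δ a < empiricalQuantile α (fun i => f (ρ i)) / s * σ a} =
        Set.univ := Set.eq_univ_of_forall fun ρ => ⟨a, by rw [ha, mul_zero]; exact hδ⟩
    rw [this, measure_univ]
  push Not at hdeg
  have hiff : ∀ a, σ a ≠ 0 → ∀ q : ℝ, δ a < q / s * σ a ↔ s * δ a / σ a < q := fun a ha q => by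
    have hpos : 0 < σ a := lt_of_le_of_ne (hσ a) ha.symm
    rw [div_lt_iff₀ hpos, div_mul_eq_mul_div, lt_div_iff₀ hs, mul_comm (δ a)]
  by_cases hne : ∃ a, σ a ≠ 0
  · have : Nonempty {a // σ a ≠ 0} := let ⟨a, ha⟩ := hne; ⟨⟨a, ha⟩⟩
    obtain ⟨a, ha⟩ := Finite.exists_min fun a : {a // σ a ≠ 0} => s * δ a / σ a
    obtain ⟨L, hL, hL0⟩ := exists_tendsto_pi_lt_empiricalQuantile ν hα hf (s * δ a / σ a)
    refine ⟨L, hL.congr fun m => ?_, fun h => Or.inr ⟨a, a.2, ?_⟩⟩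
    · congr 1
      ext ρ
      constructor
      · intro h
        exact ⟨a, (hiff a a.2 _).2 h⟩
      · rintro ⟨b, hb⟩
        by_cases hb0 : σ b = 0
        · rw [hb0, mul_zero] at hb
          exact absurd hb (not_lt.2 (hdeg b hb0))
        · exact (ha ⟨b, hb0⟩).trans_lt ((hiff b hb0 _).1 hb)
    · by_contra! hlt
      exact h (hL0 hlt)
  · push Not at hne
    refine ⟨0, tendsto_const_nhds.congr fun m => ?_, fun h => absurd rfl h⟩
    have : {ρ : Fin m → E | ∃ a, δ a < empiricalQuantile α (fun i => f (ρ i)) / s * σ a} = ∅ := by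
      ext ρ
      simp only [hne, mul_zero, Set.mem_ofPred_eq, Set.mem_empty_iff_false, iff_false, not_exists,
        not_lt]
      exact fun a => hdeg a (hne a)
    rw [this, measure_empty]

lemma posSemidef_sum_mul_div {ι : Type*} [Finite ι] {n : ℕ} (x : ι → Fin n → ℝ)
    {S : Matrix ι ι ℝ} (hS : ∀ a b, S a b = (∑ i, x a i * x b i) / n) : S.PosSemidef := by
  have : Fintype ι := Fintype.ofFinite ι
  have h : S = (n : ℝ)⁻¹ • (Matrix.of x * (Matrix.of x).conjTranspose) := by
    ext a b
    simp [hS, Matrix.mul_apply, inv_mul_eq_div]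
  rw [h]
  exact (Matrix.posSemidef_self_mul_conjTranspose _).smul (by positivity)

lemma posSemidef_integral_mul {ι O : Type*} [Finite ι] [MeasurableSpace O] {P : Measure O}
    {g : ι → O → ℝ} (hg : ∀ a, MemLp (g a) 2 P) {S : Matrix ι ι ℝ}
    (hS : ∀ a b, S a b = ∫ o, g a o * g b o ∂P) : S.PosSemidef := by
  have : Fintype ι := Fintype.ofFinite ι
  refine Matrix.PosSemidef.of_dotProduct_mulVec_nonneg ?_ fun x => ?_
  · ext a b
    simp only [Matrix.conjTranspose_apply, hS, star_trivial]
    simp_rw [mul_comm]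
  · have hint : ∀ a b, Integrable (fun o => x a * x b * (g a o * g b o)) P := fun a b =>
      ((hg a).integrable_mul (hg b)).const_mul _
    have : star x ⬝ᵥ S.mulVec x = ∫ o, (∑ a, x a * g a o) ^ 2 ∂P := by
      have h2 : ∀ o, (∑ a, x a * g a o) ^ 2 = ∑ a, ∑ b, x a * x b * (g a o * g b o) := by
        intro o
        rw [sq, Finset.sum_mul_sum]
        refine Finset.sum_congr rfl fun a _ => Finset.sum_congr rfl fun b _ => by ring
      simp_rw [h2]
      rw [integral_finsetSum _ fun a _ => integrable_finsetSum _ fun b _ => hint a b]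
      simp_rw [integral_finsetSum _ fun b _ => hint _ b, integral_const_mul, ← hS]
      simp only [dotProduct, Matrix.mulVec, Finset.mul_sum, star_trivial]
      refine Finset.sum_congr rfl fun a _ => Finset.sum_congr rfl fun b _ => by ring
    rw [this]
    exact integral_nonneg fun o => sq_nonneg _

/-! ### Measurability of the conditional miss probability in the data. -/

namespace CrossFit

variable {𝒳 : Type*} [MeasurableSpace 𝒳] {K d F : ℕ} {𝒰 : Type*} [MeasurableSpace 𝒰]
  (C : CrossFit 𝒳 K d F 𝒰) (M : DataModel 𝒳 K d) {n : ℕ}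
  {S : Finset (Fin d)} {T : ℕ} (w : S → ℝ) (π₀ : Kernel 𝒳 (Fin K))
  (pol : Fin T → Kernel 𝒳 (Fin K))

lemma measurable_diffScore (π : Kernel 𝒳 (Fin K)) (j : S) (i : Fin n) :
    Measurable fun ω : (Fin n → Obs 𝒳 K d) × 𝒰 => C.diffScore M w π₀ ω π j i :=
  (C.measurable_fittedScore M π j i).sub ((C.measurable_fittedScore M π₀ j i).const_mul _)

lemma measurable_diffHat (π : Kernel 𝒳 (Fin K)) (j : S) :
    Measurable fun ω : (Fin n → Obs 𝒳 K d) × 𝒰 => C.diffHat M w π₀ ω π j := by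
  unfold diffHat valueHat
  exact ((Finset.measurable_sum _ fun i _ => C.measurable_fittedScore M π j i).div_const _).sub
    (((Finset.measurable_sum _ fun i _ =>
      C.measurable_fittedScore M π₀ j i).div_const _).const_mul _)

lemma measurable_covHat (a b : Fin T × S) :
    Measurable fun ω : (Fin n → Obs 𝒳 K d) × 𝒰 => C.covHat M w π₀ pol ω a b := by
  unfold covHat
  exact (Finset.measurable_sum _ fun i _ =>
    ((C.measurable_diffScore M w π₀ _ _ i).sub (C.measurable_diffHat M w π₀ _ _)).mul
    ((C.measurable_diffScore M w π₀ _ _ i).sub (C.measurable_diffHat M w π₀ _ _))).div_const _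

lemma posSemidef_covHat (ω : (Fin n → Obs 𝒳 K d) × 𝒰) : (C.covHat M w π₀ pol ω).PosSemidef :=
  posSemidef_sum_mul_div
    (fun a i => C.diffScore M w π₀ ω (pol a.1) a.2 i - C.diffHat M w π₀ ω (pol a.1) a.2)
    fun _ _ => by simp only [covHat]

/-- The event that a lower bound exceeds its target. -/
def missSet (α : ℝ) (n m : ℕ) :
    Set (((Fin n → Obs 𝒳 K d) × 𝒰) × (Fin m → EuclideanSpace ℝ (Fin T × S))) :=
  {p | ∃ (t : Fin T) (j : S), M.policyValue (pol t) j - (1 + w j) * M.policyValue π₀ j <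
    C.lowerBound M w π₀ pol α p.1 p.2 t j}

lemma measurableSet_missSet {α : ℝ} (hα : α ∈ Set.Ioo (0 : ℝ) 1) (n m : ℕ) :
    MeasurableSet (C.missSet M w π₀ pol α n m) := by
  have hcrit : Measurable fun p : ((Fin n → Obs 𝒳 K d) × 𝒰) ×
      (Fin m → EuclideanSpace ℝ (Fin T × S)) => C.critValue M w π₀ pol α p.1 p.2 := by
    unfold critValue
    refine (measurable_empiricalQuantile hα).comp (measurable_pi_lambda _ fun s => ?_)
    refine Measurable.iInf fun a => Measurable.div ?_ ?_
    · fun_prop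
    · exact ((C.measurable_covHat M w π₀ pol a a).comp measurable_fst).sqrt
  have : C.missSet M w π₀ pol α n m = ⋃ t, ⋃ j : S, {p | M.policyValue (pol t) j -
      (1 + w j) * M.policyValue π₀ j < C.lowerBound M w π₀ pol α p.1 p.2 t j} := by
    ext p
    simp only [missSet, Set.mem_ofPred_eq, Set.mem_iUnion]
  rw [this]
  refine MeasurableSet.iUnion fun t => MeasurableSet.iUnion fun j =>
    measurableSet_lt measurable_const ?_
  exact ((C.measurable_diffHat M w π₀ (pol t) j).comp measurable_fst).add
    ((hcrit.div_const _).mul ((C.measurable_covHat M w π₀ pol (t, j) (t, j)).comp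
      measurable_fst).sqrt)

/-- The simulated vectors are images of standard Gaussians under `sqrtMap` of the estimated
covariance. A measure varying with the data thus becomes a fixed product measure of a varying
section of one measurable set. -/
lemma measurable_pi_missSet {α : ℝ} (hα : α ∈ Set.Ioo (0 : ℝ) 1) (n m : ℕ) :
    Measurable fun ω : (Fin n → Obs 𝒳 K d) × 𝒰 =>
      (Measure.pi fun _ : Fin m => multivariateGaussian 0 (C.covHat M w π₀ pol ω))
        {ρ | (ω, ρ) ∈ C.missSet M w π₀ pol α n m} := by
  set std := Measure.pi fun _ : Fin m => stdGaussian (EuclideanSpace ℝ (Fin T × S)) with hstd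
  set Φ : ((Fin n → Obs 𝒳 K d) × 𝒰) × (Fin m → EuclideanSpace ℝ (Fin T × S)) →
      ((Fin n → Obs 𝒳 K d) × 𝒰) × (Fin m → EuclideanSpace ℝ (Fin T × S)) :=
    fun p => (p.1, fun s => sqrtMap (C.covHat M w π₀ pol p.1) (p.2 s)) with hΦ
  have hsq : Measurable fun p : ((Fin n → Obs 𝒳 K d) × 𝒰) × EuclideanSpace ℝ (Fin T × S) =>
      sqrtMap (C.covHat M w π₀ pol p.1) p.2 := by
    have h := measurable_pi_lambda _ fun a => measurable_uncurry_sqrtMap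
      (S := fun ω : (Fin n → Obs 𝒳 K d) × 𝒰 => C.covHat M w π₀ pol ω)
      (fun ω => C.posSemidef_covHat M w π₀ pol ω) (C.measurable_covHat M w π₀ pol) a
    exact (WithLp.measurable_toLp 2 _).comp h
  have hΦm : Measurable Φ := by
    refine measurable_fst.prodMk (measurable_pi_lambda _ fun s => ?_)
    exact hsq.comp (f := fun p : ((Fin n → Obs 𝒳 K d) × 𝒰) ×
      (Fin m → EuclideanSpace ℝ (Fin T × S)) => (p.1, p.2 s)) (by fun_prop)
  have hE := C.measurableSet_missSet M w π₀ pol hα n m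
  have heq : ∀ ω, (Measure.pi fun _ : Fin m => multivariateGaussian 0 (C.covHat M w π₀ pol ω))
      {ρ | (ω, ρ) ∈ C.missSet M w π₀ pol α n m} =
      std (Prod.mk ω ⁻¹' (Φ ⁻¹' C.missSet M w π₀ pol α n m)) := fun ω => by
    have hp : ∀ _ : Fin m, IsProbabilityMeasure ((stdGaussian (EuclideanSpace ℝ (Fin T × S))).map
        (sqrtMap (C.covHat M w π₀ pol ω))) := fun _ =>
      Measure.isProbabilityMeasure_map (measurable_sqrtMap _).aemeasurable
    simp_rw [multivariateGaussian_eq_map]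
    have hmm : Measurable fun (x : Fin m → EuclideanSpace ℝ (Fin T × S)) s =>
        sqrtMap (C.covHat M w π₀ pol ω) (x s) := measurable_pi_lambda _ fun s =>
      (measurable_sqrtMap _).comp (measurable_pi_apply s)
    have hsl : MeasurableSet {ρ | (ω, ρ) ∈ C.missSet M w π₀ pol α n m} := measurable_prodMk_left hE
    rw [← Measure.pi_map_pi fun _ => (measurable_sqrtMap _).aemeasurable,
      Measure.map_apply hmm hsl]
    rfl
  simp_rw [heq]
  exact measurable_measure_prodMk_left (hΦm hE)

end CrossFit

/-! ### Asymptotic validity -/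

lemma euclidean_norm_le_sum_abs {ι : Type*} [Fintype ι] (x : EuclideanSpace ℝ ι) :
    ‖x‖ ≤ ∑ a, |x a| := by
  rw [EuclideanSpace.norm_eq]
  refine Real.sqrt_le_iff.2 ⟨Finset.sum_nonneg fun a _ => abs_nonneg _, ?_⟩
  simp only [Real.norm_eq_abs]
  exact Finset.sum_sq_le_sq_sum_of_nonneg fun a _ => abs_nonneg _

lemma pi_pi_norm_le_sum_abs {ι : Type*} [Fintype ι] (x : ι → ι → ℝ) :
    ‖x‖ ≤ ∑ a, ∑ b, |x a b| := by
  refine (pi_norm_le_iff_of_nonneg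
    (Finset.sum_nonneg fun a _ => Finset.sum_nonneg fun b _ => abs_nonneg _)).2 fun a => ?_
  refine (pi_norm_le_iff_of_nonneg
    (Finset.sum_nonneg fun a _ => Finset.sum_nonneg fun b _ => abs_nonneg _)).2 fun b => ?_
  rw [Real.norm_eq_abs]
  exact (Finset.single_le_sum (f := fun b => |x a b|) (fun b _ => abs_nonneg _)
    (Finset.mem_univ b)).trans (Finset.single_le_sum (f := fun a => ∑ b, |x a b|)
    (fun a _ => Finset.sum_nonneg fun b _ => abs_nonneg _) (Finset.mem_univ a))

namespace CrossFit

variable {𝒳 : Type*} [MeasurableSpace 𝒳] {K d F : ℕ} {𝒰 : Type*} [MeasurableSpace 𝒰]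
  (C : CrossFit 𝒳 K d F 𝒰) (M : DataModel 𝒳 K d)
  {S : Finset (Fin d)} {T : ℕ} (w : S → ℝ) (π₀ : Kernel 𝒳 (Fin K))
  (pol : Fin T → Kernel 𝒳 (Fin K))

/-- The target `V_j(π_t) - (1 + w_j) V_j(π₀)`. -/
def target (a : Fin T × S) : ℝ :=
  M.policyValue (pol a.1) a.2 - (1 + w a.2) * M.policyValue π₀ a.2

/-- The centred true score of a contrast. -/
def centred (a : Fin T × S) (o : Obs 𝒳 K d) : ℝ :=
  M.trueDiff (w a.2) π₀ (pol a.1) a.2 o - target M w π₀ pol a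

/-- The asymptotic covariance matrix. -/
def trueCov (a b : Fin T × S) : ℝ :=
  ∫ o, centred M w π₀ pol a o * centred M w π₀ pol b o ∂M.obsLaw

/-- The estimation errors of the scores of a contrast. -/
def rem {n : ℕ} (a : Fin T × S) (ω : (Fin n → Obs 𝒳 K d) × 𝒰) (i : Fin n) : ℝ :=
  C.diffRem M (w a.2) π₀ (pol a.1) ω a.2 i

section Algebra

variable {n : ℕ} (ω : (Fin n → Obs 𝒳 K d) × 𝒰) (a b : Fin T × S)

lemma diffScore_eq (i : Fin n) : C.diffScore M w π₀ ω (pol a.1) a.2 i =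
    centred M w π₀ pol a (ω.1 i) + C.rem M w π₀ pol a ω i + target M w π₀ pol a := by
  unfold diffScore centred rem diffRem scoreRem DataModel.trueDiff
  ring

lemma diffHat_eq (hn : 0 < n) : C.diffHat M w π₀ ω (pol a.1) a.2 =
    (∑ i, (centred M w π₀ pol a (ω.1 i) + C.rem M w π₀ pol a ω i)) / n +
      target M w π₀ pol a := by
  have hn' : (n : ℝ) ≠ 0 := by positivity
  have h1 : C.diffHat M w π₀ ω (pol a.1) a.2 =
      (∑ i, C.diffScore M w π₀ ω (pol a.1) a.2 i) / n := by
    unfold diffHat valueHat diffScore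
    rw [Finset.sum_sub_distrib, ← Finset.mul_sum]
    ring
  rw [h1]
  simp_rw [C.diffScore_eq M w π₀ pol ω a]
  rw [Finset.sum_add_distrib]
  simp only [Finset.sum_const, Finset.card_univ, Fintype.card_fin, nsmul_eq_mul]
  field_simp

lemma covHat_eq (hn : 0 < n) : C.covHat M w π₀ pol ω a b =
    (∑ i, (centred M w π₀ pol a (ω.1 i) + C.rem M w π₀ pol a ω i -
      (∑ i, (centred M w π₀ pol a (ω.1 i) + C.rem M w π₀ pol a ω i)) / n) *
      (centred M w π₀ pol b (ω.1 i) + C.rem M w π₀ pol b ω i -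
      (∑ i, (centred M w π₀ pol b (ω.1 i) + C.rem M w π₀ pol b ω i)) / n)) / n := by
  unfold covHat
  simp_rw [C.diffScore_eq M w π₀ pol ω, C.diffHat_eq M w π₀ pol ω _ hn, add_sub_add_right_eq_sub]

/-- The error is written as target minus estimate, as in the miss event. The resulting sign is
harmless: negating all the scores leaves their covariance, hence the Gaussian limit, unchanged. -/
lemma sqrt_mul_target_sub_diffHat (hn : 0 < n) :
    √n * (target M w π₀ pol a - C.diffHat M w π₀ ω (pol a.1) a.2) =
      (√n)⁻¹ * ∑ i, -centred M w π₀ pol a (ω.1 i) +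
        -1 * ((√n)⁻¹ * ∑ i, C.rem M w π₀ pol a ω i) := by
  have hs : 0 < √(n : ℝ) := Real.sqrt_pos.2 (by exact_mod_cast hn)
  have hsn : (n : ℝ) = √n * √n := (Real.mul_self_sqrt (Nat.cast_nonneg n)).symm
  rw [C.diffHat_eq M w π₀ pol ω a hn, Finset.sum_add_distrib, Finset.sum_neg_distrib]
  generalize ∑ i, centred M w π₀ pol a (ω.1 i) = x
  generalize ∑ i, C.rem M w π₀ pol a ω i = y
  generalize √(n : ℝ) = s at hs hsn
  rw [hsn]
  field_simp
  ring

end Algebra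

section Asymptotics

variable [IsMarkovKernel π₀] [∀ t, IsMarkovKernel (pol t)]
  {c : ℝ} (hc : 0 < c) (hpos : ∀ᵐ x ∂M.covariateLaw, ∀ k, c ≤ M.propensity k x)

omit [IsMarkovKernel π₀] [∀ t, IsMarkovKernel (pol t)] in
lemma measurable_centred (a : Fin T × S) : Measurable (centred M w π₀ pol a) :=
  (M.measurable_trueDiff _ _ _ _).sub_const _

include hc hpos in
lemma memLp_centred (a : Fin T × S) : MemLp (centred M w π₀ pol a) 2 M.obsLaw :=
  (M.memLp_trueDiff hc hpos _ _ _ _).sub (memLp_const _)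

include hc hpos in
lemma integral_centred (a : Fin T × S) : ∫ o, centred M w π₀ pol a o ∂M.obsLaw = 0 := by
  unfold centred
  rw [integral_sub ((M.memLp_trueDiff hc hpos _ _ _ _).integrable one_le_two)
    (integrable_const _), M.integral_trueDiff hc hpos]
  simp [target]

include hc hpos in
lemma exists_ae_abs_centred_le :
    ∃ B : ℝ, 0 ≤ B ∧ ∀ᵐ o ∂M.obsLaw, ∀ a : Fin T × S, |centred M w π₀ pol a o| ≤ B := by
  refine ⟨∑ a : Fin T × S, ((1 + |1 + w a.2|) * (c⁻¹ + 1) + |target M w π₀ pol a|),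
    Finset.sum_nonneg fun a _ => by positivity, ?_⟩
  rw [ae_all_iff]
  intro a
  filter_upwards [M.ae_abs_trueDiff_le hc hpos (w a.2) π₀ (pol a.1) a.2] with o ho
  refine ((abs_sub _ _).trans (add_le_add ho le_rfl)).trans ?_
  exact Finset.single_le_sum
    (f := fun a : Fin T × S => (1 + |1 + w a.2|) * (c⁻¹ + 1) + |target M w π₀ pol a|)
    (fun a _ => by positivity) (Finset.mem_univ a)

include hc hpos in
lemma posSemidef_trueCov : (Matrix.of (trueCov M w π₀ pol)).PosSemidef :=
  posSemidef_integral_mul (fun a => memLp_centred M w π₀ pol hc hpos a) fun _ _ => rfl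

include hc hpos in
lemma vanishes_covHat_sub (hcons : ∀ j ∈ S, C.IsConsistent M j) (a b : Fin T × S) :
    VanishesInProb (C.sampleLaw M)
      fun n ω => C.covHat M w π₀ pol ω a b - trueCov M w π₀ pol a b := by
  obtain ⟨B, hB0, hB⟩ := exists_ae_abs_centred_le M w π₀ pol hc hpos
  have hq : ∀ a : Fin T × S, VanishesInProb (C.sampleLaw M)
      fun n ω => √((∑ i, C.rem M w π₀ pol a ω i ^ 2) / n) := fun a =>
    (C.vanishes_sum_diffRem_sq M hc hpos (w a.2) π₀ (pol a.1) (hcons a.2 a.2.2)).sqrt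
  have hu : ∀ a : Fin T × S, VanishesInProb (C.sampleLaw M)
      fun n ω => |(∑ i, centred M w π₀ pol a (ω.1 i)) / n| := fun a => by
    refine (C.vanishes_of_pi M (f := fun n o => (∑ i, centred M w π₀ pol a (o i)) / n) ?_).abs
    intro ε hε
    have := tendsto_pi_mean M.obsLaw (memLp_centred M w π₀ pol hc hpos a) hε
    simpa only [integral_centred M w π₀ pol hc hpos a, sub_zero] using this
  have huu : VanishesInProb (C.sampleLaw M) fun n ω =>
      |(∑ i, centred M w π₀ pol a (ω.1 i) * centred M w π₀ pol b (ω.1 i)) / n -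
        trueCov M w π₀ pol a b| := by
    refine (C.vanishes_of_pi M (f := fun n o => (∑ i, centred M w π₀ pol a (o i) *
      centred M w π₀ pol b (o i)) / n - trueCov M w π₀ pol a b) ?_).abs
    intro ε hε
    refine tendsto_pi_mean M.obsLaw
      (g := fun o => centred M w π₀ pol a o * centred M w π₀ pol b o) ?_ hε
    refine MemLp.of_bound ((measurable_centred M w π₀ pol a).mul
      (measurable_centred M w π₀ pol b)).aestronglyMeasurable (B * B) ?_
    filter_upwards [hB] with o ho
    rw [norm_mul]
    exact mul_le_mul (ho a) (ho b) (norm_nonneg _) hB0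
  have hall := (((huu.add ((hq b).const_mul B)).add ((hq a).const_mul B)).add
    ((hq a).mul (hq b))).add (((hu a).add (hq a)).mul ((hu b).add (hq b)))
  refine hall.mono ?_
  filter_upwards [eventually_gt_atTop 0] with n hn
  filter_upwards [C.ae_sampleLaw_forall M hB n] with ω hω
  rw [C.covHat_eq M w π₀ pol ω a b hn]
  exact (abs_empiricalCov_sub_le hn hB0 _ _ _ _ (fun i => hω i a) (fun i => hω i b)).trans
    (le_abs_self _)

include hc hpos in
lemma tendstoInDistribution_centred :
    TendstoInDistribution
      (fun n (ω : (Fin n → Obs 𝒳 K d) × 𝒰) =>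
        (WithLp.toLp 2 fun a => (√n)⁻¹ * ∑ i, -centred M w π₀ pol a (ω.1 i) :
          EuclideanSpace ℝ (Fin T × S))) atTop id
      (fun n => C.sampleLaw M n) (multivariateGaussian 0 (Matrix.of (trueCov M w π₀ pol))) := by
  have h := tendstoInDistribution_pi_sum_euclidean M.obsLaw
    (g := fun a o => -centred M w π₀ pol a o) (fun a => (measurable_centred M w π₀ pol a).neg)
    (fun a => (memLp_centred M w π₀ pol hc hpos a).neg)
    (fun a => by rw [integral_neg, integral_centred M w π₀ pol hc hpos, neg_zero])
    (posSemidef_trueCov M w π₀ pol hc hpos)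
    (fun a b => by simp only [Matrix.of_apply, trueCov, neg_mul_neg])
  have hm : ∀ n : ℕ, Measurable fun o : Fin n → Obs 𝒳 K d =>
      (WithLp.toLp 2 fun a => (√n)⁻¹ * ∑ i, -centred M w π₀ pol a (o i) :
          EuclideanSpace ℝ (Fin T × S)) := fun n => by
    refine (WithLp.measurable_toLp 2 _).comp (measurable_pi_lambda _ fun a => ?_)
    exact (Finset.measurable_sum _ fun i _ =>
      ((measurable_centred M w π₀ pol a).comp (measurable_pi_apply i)).neg).const_mul _
  refine ⟨fun n => ((hm n).comp measurable_fst).aemeasurable, aemeasurable_id, ?_⟩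
  refine h.tendsto.congr fun n => Subtype.ext ?_
  change Measure.map _ _ = Measure.map _ _
  conv_lhs => rw [← (C.measurePreserving_fst_sampleLaw M n).map_eq,
    Measure.map_map (hm n) measurable_fst]
  rfl

include hc hpos in
/-- A contrast with vanishing asymptotic variance is almost surely constantly zero. -/
lemma ae_degenerate {v : ℝ} (hv : 0 < v) {a : Fin T × S}
    (hvar : ∀ᵐ x ∂M.covariateLaw, ∀ k, v ≤ M.outcomeVar a.2 k x)
    (h0 : trueCov M w π₀ pol a a = 0) (n : ℕ) :
    ∀ᵐ ω ∂(C.sampleLaw M n), C.covHat M w π₀ pol ω a a = 0 ∧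
      target M w π₀ pol a - C.diffHat M w π₀ ω (pol a.1) a.2 = 0 := by
  have hV : Var[M.trueDiff (w a.2) π₀ (pol a.1) a.2; M.obsLaw] = 0 := by
    rw [variance_eq_integral (M.measurable_trueDiff _ _ _ _).aemeasurable,
      M.integral_trueDiff hc hpos, ← h0]
    unfold trueCov centred target
    simp only [sq]
  obtain ⟨hw, hπ⟩ := M.eq_baseline_of_variance_eq_zero hc hpos _ π₀ (pol a.1) a.2 hv hvar hV
  have hobs : ∀ᵐ o ∂M.obsLaw, ∀ k, (pol a.1 o.1.1).real {k} = (π₀ o.1.1).real {k} :=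
    M.measurePreserving_fst_obsLaw.quasiMeasurePreserving.ae
      (M.measurePreserving_fst_designLaw.quasiMeasurePreserving.ae hπ)
  have htar : target M w π₀ pol a = 0 := by
    unfold target DataModel.policyValue
    rw [hw, add_zero, one_mul, sub_eq_zero]
    refine integral_congr_ae ?_
    filter_upwards [hπ] with x hx
    simp only [hx]
  filter_upwards [C.ae_sampleLaw_forall M hobs n] with ω hω
  have hfit : ∀ i, C.fittedScore M ω (pol a.1) a.2 i = C.fittedScore M ω π₀ a.2 i := fun i => by
    unfold fittedScore DataModel.policyScore
    simp only [hω i]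
  have hhat : C.diffHat M w π₀ ω (pol a.1) a.2 = 0 := by
    unfold diffHat valueHat
    simp only [hfit, hw, add_zero, one_mul, sub_self]
  refine ⟨?_, by rw [htar, hhat, sub_zero]⟩
  unfold covHat diffScore
  simp only [hfit, hw, hhat, add_zero, one_mul, sub_self, mul_zero, Finset.sum_const_zero, zero_div]

end Asymptotics

end CrossFit

/-! ### Conditional miss probabilities and comparison with the Gaussian limit. -/

namespace CrossFit

variable {𝒳 : Type*} [MeasurableSpace 𝒳] {K d F : ℕ} {𝒰 : Type*} [MeasurableSpace 𝒰]
  (C : CrossFit 𝒳 K d F 𝒰) (M : DataModel 𝒳 K d)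
  {S : Finset (Fin d)} {T : ℕ} (w : S → ℝ) (π₀ : Kernel 𝒳 (Fin K))
  (pol : Fin T → Kernel 𝒳 (Fin K))

/-- Given the data, the miss probability converges as the number of simulated vectors grows; a
nonzero limit forces a degenerate bound below its target, or a studentized error in the lower tail
of the simulated distribution. -/
lemma exists_tendsto_pi_missSet {α : ℝ} (hα : α ∈ Set.Ioo (0 : ℝ) 1) (n : ℕ)
    (ω : (Fin n → Obs 𝒳 K d) × 𝒰) :
    ∃ L : ℝ≥0∞, Tendsto (fun m : ℕ =>
      (Measure.pi fun _ : Fin m => multivariateGaussian 0 (C.covHat M w π₀ pol ω))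
        {ρ | (ω, ρ) ∈ C.missSet M w π₀ pol α n m}) atTop (𝓝 L) ∧
      (0 < n → L ≠ 0 →
        (∃ a, √(C.covHat M w π₀ pol ω a a) = 0 ∧
          target M w π₀ pol a - C.diffHat M w π₀ ω (pol a.1) a.2 < 0) ∨
        ∃ a, √(C.covHat M w π₀ pol ω a a) ≠ 0 ∧
          multivariateGaussian 0 (C.covHat M w π₀ pol ω)
            {ρ | ⨅ b, ρ b / √(C.covHat M w π₀ pol ω b b) ≤
              √n * (target M w π₀ pol a - C.diffHat M w π₀ ω (pol a.1) a.2) /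
                √(C.covHat M w π₀ pol ω a a)} ≤ ENNReal.ofReal α) := by
  have hset : ∀ m : ℕ, {ρ : Fin m → EuclideanSpace ℝ (Fin T × S) |
      (ω, ρ) ∈ C.missSet M w π₀ pol α n m} =
      {ρ | ∃ a, target M w π₀ pol a - C.diffHat M w π₀ ω (pol a.1) a.2 <
        empiricalQuantile α (fun s => ⨅ b, ρ s b / √(C.covHat M w π₀ pol ω b b)) / √n *
          √(C.covHat M w π₀ pol ω a a)} := fun m => by
    ext ρ
    simp only [missSet, lowerBound, critValue, target, Set.mem_ofPred_eq, sub_lt_iff_lt_add',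
      Prod.exists]
  simp_rw [hset]
  rcases n.eq_zero_or_pos with rfl | hn
  -- For `n = 0` division by `√0` gives `0`, so the miss event no longer depends on the simulated
  -- vectors and has probability `0` or `1`.
  · simp only [Nat.cast_zero, Real.sqrt_zero, div_zero, zero_mul]
    by_cases h : ∃ a, target M w π₀ pol a - C.diffHat M w π₀ ω (pol a.1) a.2 < 0
    · exact ⟨1, tendsto_const_nhds.congr fun m => by
        simp only [h]
        exact measure_univ.symm, fun h0 => absurd h0 (lt_irrefl _)⟩
    · exact ⟨0, tendsto_const_nhds.congr fun m => by
        simp only [h]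
        exact measure_empty.symm, fun h0 => absurd h0 (lt_irrefl _)⟩
  · have hf : Measurable fun ρ : EuclideanSpace ℝ (Fin T × S) =>
        ⨅ b, ρ b / √(C.covHat M w π₀ pol ω b b) := Measurable.iInf fun b => by fun_prop
    obtain ⟨L, hL, hL0⟩ := exists_tendsto_pi_miss
      (multivariateGaussian 0 (C.covHat M w π₀ pol ω)) hα hf
      (fun a => target M w π₀ pol a - C.diffHat M w π₀ ω (pol a.1) a.2)
      (fun a => √(C.covHat M w π₀ pol ω a a)) (fun a => Real.sqrt_nonneg _)
      (s := √n) (Real.sqrt_pos.2 (by exact_mod_cast hn))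
    exact ⟨L, hL, fun _ => hL0⟩

section Asymptotics

variable [IsMarkovKernel π₀] [∀ t, IsMarkovKernel (pol t)]
  {c : ℝ} (hc : 0 < c) (hpos : ∀ᵐ x ∂M.covariateLaw, ∀ k, c ≤ M.propensity k x)

include hc hpos in
lemma limsup_sampleLaw_rejectSet_le (hcons : ∀ j ∈ S, C.IsConsistent M j) (β : ℝ≥0∞)
    {N : Finset (Fin T × S)} (hN : ∀ a ∈ N, 0 < trueCov M w π₀ pol a a) :
    limsup (fun n : ℕ => C.sampleLaw M n {ω | ∃ a ∈ N,
      ((WithLp.toLp 2 fun a => √n * (target M w π₀ pol a - C.diffHat M w π₀ ω (pol a.1) a.2) :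
        EuclideanSpace ℝ (Fin T × S)), fun a b => C.covHat M w π₀ pol ω a b) ∈
          rejectSet N β a}) atTop ≤ β := by
  have hS := posSemidef_trueCov M w π₀ pol hc hpos
  have hXm : ∀ n : ℕ, Measurable fun ω : (Fin n → Obs 𝒳 K d) × 𝒰 =>
      (WithLp.toLp 2 fun a => (√n)⁻¹ * ∑ i, -centred M w π₀ pol a (ω.1 i) :
        EuclideanSpace ℝ (Fin T × S)) := fun n => by
    refine (WithLp.measurable_toLp 2 _).comp (measurable_pi_lambda _ fun a => ?_)
    exact (Finset.measurable_sum _ fun i _ => ((measurable_centred M w π₀ pol a).comp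
      ((measurable_pi_apply i).comp measurable_fst)).neg).const_mul _
  have hrem : ∀ (n : ℕ) a i, Measurable fun ω : (Fin n → Obs 𝒳 K d) × 𝒰 =>
      C.rem M w π₀ pol a ω i := fun n a i => by
    have h : ∀ ω : (Fin n → Obs 𝒳 K d) × 𝒰, C.rem M w π₀ pol a ω i =
        C.diffScore M w π₀ ω (pol a.1) a.2 i - centred M w π₀ pol a (ω.1 i) -
          target M w π₀ pol a := fun ω => by
      rw [C.diffScore_eq M w π₀ pol ω a i]
      ring
    simp_rw [h]
    exact ((C.measurable_diffScore M w π₀ _ _ i).sub ((measurable_centred M w π₀ pol a).comp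
      ((measurable_pi_apply i).comp measurable_fst))).sub_const _
  have hRm : ∀ n : ℕ, Measurable fun ω : (Fin n → Obs 𝒳 K d) × 𝒰 =>
      (WithLp.toLp 2 fun a => -1 * ((√n)⁻¹ * ∑ i, C.rem M w π₀ pol a ω i) :
        EuclideanSpace ℝ (Fin T × S)) := fun n => by
    refine (WithLp.measurable_toLp 2 _).comp (measurable_pi_lambda _ fun a => ?_)
    exact ((Finset.measurable_sum _ fun i _ => hrem n a i).const_mul _).const_mul _
  have hYm : ∀ n : ℕ, Measurable fun (ω : (Fin n → Obs 𝒳 K d) × 𝒰) (a b : Fin T × S) =>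
      C.covHat M w π₀ pol ω a b := fun n =>
    measurable_pi_lambda _ fun a => measurable_pi_lambda _ fun b =>
      C.measurable_covHat M w π₀ pol a b
  have hR : VanishesInProb (C.sampleLaw M) fun n ω =>
      ‖(WithLp.toLp 2 fun a => -1 * ((√n)⁻¹ * ∑ i, C.rem M w π₀ pol a ω i) :
        EuclideanSpace ℝ (Fin T × S))‖ := by
    have h := VanishesInProb.sum (s := Finset.univ) fun (a : Fin T × S) _ =>
      ((C.vanishes_sum_diffRem M hc hpos (w a.2) π₀ (pol a.1)
        (hcons a.2 a.2.2)).const_mul (-1)).abs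
    refine h.mono (Eventually.of_forall fun n => Eventually.of_forall fun ω => ?_)
    rw [abs_norm]
    exact (euclidean_norm_le_sum_abs _).trans (le_abs_self _)
  have hY : VanishesInProb (C.sampleLaw M) fun n ω =>
      ‖(fun a b => C.covHat M w π₀ pol ω a b) - trueCov M w π₀ pol‖ := by
    have h := VanishesInProb.sum (s := Finset.univ) fun (a : Fin T × S) _ =>
      VanishesInProb.sum (s := Finset.univ) fun (b : Fin T × S) _ =>
      (C.vanishes_covHat_sub M w π₀ pol hc hpos hcons a b).abs
    refine h.mono (Eventually.of_forall fun n => Eventually.of_forall fun ω => ?_)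
    rw [abs_norm]
    exact (pi_pi_norm_le_sum_abs _).trans (le_abs_self _)
  have key := limsup_measure_le_of_tendstoInDistribution (fun n => C.sampleLaw M n) hXm hRm hYm
    (C.tendstoInDistribution_centred M w π₀ pol hc hpos) hR hY (⋃ a ∈ N, rejectSet N β a)
  refine le_trans (le_of_eq (limsup_congr ?_)) (key.trans ?_)
  · filter_upwards [eventually_gt_atTop 0] with n hn
    congr 1
    ext ω
    simp only [Set.mem_ofPred_eq, Set.mem_iUnion, exists_prop,
      C.sqrt_mul_target_sub_diffHat M w π₀ pol ω _ hn]
    rfl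
  · refine (measure_mono fun x hx => ?_).trans
      (multivariateGaussian_rejectSet_le N β (trueCov M w π₀ pol))
    simp only [Finset.closure_biUnion, Set.mem_ofPred_eq, Set.mem_iUnion, exists_prop] at hx ⊢
    obtain ⟨a, ha, hxa⟩ := hx
    exact ⟨a, ha, mem_rejectSet_of_mem_closure ha hS hN hxa⟩

include hc hpos in
-- A zero estimated variance would deviate from the limiting variance by the whole positive amount
-- of the latter.
lemma tendsto_sampleLaw_covHat_eq_zero (hcons : ∀ j ∈ S, C.IsConsistent M j)
    {N : Finset (Fin T × S)} (hN : ∀ a ∈ N, 0 < trueCov M w π₀ pol a a) :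
    Tendsto (fun n : ℕ => C.sampleLaw M n {ω | ∃ a ∈ N, C.covHat M w π₀ pol ω a a = 0})
      atTop (𝓝 0) := by
  have h : Tendsto (fun n : ℕ => ∑ a ∈ N, C.sampleLaw M n {ω | trueCov M w π₀ pol a a ≤
      |C.covHat M w π₀ pol ω a a - trueCov M w π₀ pol a a|}) atTop (𝓝 (∑ a ∈ N, 0)) :=
    tendsto_finsetSum _ fun a ha =>
      C.vanishes_covHat_sub M w π₀ pol hc hpos hcons a a _ (hN a ha)
  rw [Finset.sum_const_zero] at h
  refine tendsto_of_tendsto_of_tendsto_of_le_of_le tendsto_const_nhds h (fun _ => zero_le)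
    fun n => (measure_mono ?_).trans (measure_biUnion_finset_le N _)
  rintro ω ⟨a, ha, h0⟩
  refine Set.mem_biUnion (Finset.mem_coe.2 ha) ?_
  simp only [Set.mem_ofPred_eq, h0, zero_sub, abs_neg]
  exact le_abs_self _

end Asymptotics

end CrossFit

end SafePolicy

end

theorem mainTheorem4 {𝒳 𝒰 : Type*} [MeasurableSpace 𝒳] [MeasurableSpace 𝒰] {K d F T : ℕ}
    (M : SafePolicy.DataModel 𝒳 K d) (C : SafePolicy.CrossFit 𝒳 K d F 𝒰)
    (S : Finset (Fin d)) (w : S → ℝ)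
    (π₀ : Kernel 𝒳 (Fin K)) (hπ₀ : IsMarkovKernel π₀)
    (pol : Fin T → Kernel 𝒳 (Fin K)) (hpol : ∀ t, IsMarkovKernel (pol t))
    (α : ℝ) (hα : α ∈ Set.Ioo (0 : ℝ) 1)
    -- strict positivity
    (c : ℝ) (hc : c ∈ Set.Ioo (0 : ℝ) 1)
    (hpos : ∀ᵐ x ∂M.covariateLaw, ∀ k, c ≤ M.propensity k x)
    -- (i) the estimated regressions are almost surely bounded
    (hbdd : ∀ (n : ℕ) (l : Fin F), ∀ᵐ ω ∂(C.sampleLaw M n), ∃ B : ℝ, ∀ j ∈ S,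
      ∀ᵐ q ∂M.designLaw, |C.muHat ω l j q.2 q.1| ≤ B)
    -- (ii) they are consistent in `L²(P)`
    (hcons : ∀ (l : Fin F), ∀ j ∈ S, ∀ ε : ℝ≥0∞, 0 < ε →
      Tendsto (fun n => C.sampleLaw M n {ω | ε ≤
        eLpNorm (fun q : 𝒳 × Fin K => C.muHat ω l j q.2 q.1 - M.outcomeMean j q.2 q.1)
          2 M.designLaw}) atTop (𝓝 0))
    -- (iii) the conditional variances are bounded below
    (v : ℝ) (hv : 0 < v)
    (hvar : ∀ᵐ x ∂M.covariateLaw, ∀ k, ∀ j ∈ S, v ≤ M.outcomeVar j k x) :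
    ∃ p : ℕ → ℝ≥0∞,
      (∀ n, Tendsto (fun m => C.missProb M w π₀ pol α n m) atTop (𝓝 (p n))) ∧
      limsup p atTop ≤ ENNReal.ofReal α := by
  have hcons' : ∀ j ∈ S, C.IsConsistent M j := fun j hj l => hcons l j hj
  choose L hL hL0 using C.exists_tendsto_pi_missSet M w π₀ pol hα
  refine ⟨fun n => ∫⁻ ω, L n ω ∂(C.sampleLaw M n), fun n => ?_, ?_⟩
  · refine tendsto_lintegral_of_dominated_convergence (fun _ => 1)
      (fun m => C.measurable_pi_missSet M w π₀ pol hα n m)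
      (fun m => Eventually.of_forall fun ω => prob_le_one) (by simp)
      (Eventually.of_forall fun ω => hL n ω)
  have hL1 : ∀ n ω, L n ω ≤ 1 := fun n ω => le_of_tendsto' (hL n ω) fun m => prob_le_one
  set N : Finset (Fin T × S) :=
    Finset.univ.filter fun a => SafePolicy.CrossFit.trueCov M w π₀ pol a a ≠ 0 with hNdef
  have hN : ∀ a ∈ N, 0 < SafePolicy.CrossFit.trueCov M w π₀ pol a a := fun a ha =>
    lt_of_le_of_ne ((SafePolicy.CrossFit.posSemidef_trueCov M w π₀ pol hc.1 hpos).diag_nonneg (i := a))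
      (Finset.mem_filter.1 ha).2.symm
  have h1 := C.limsup_sampleLaw_rejectSet_le M w π₀ pol hc.1 hpos hcons' (ENNReal.ofReal α) hN
  have h2 := C.tendsto_sampleLaw_covHat_eq_zero M w π₀ pol hc.1 hpos hcons' hN
  -- A limiting miss needs either a rejection within `N` or a vanishing estimated variance within
  -- `N`; the second event is asymptotically negligible.
  rw [← ENNReal.limsup_add_of_right_tendsto_zero h2] at h1
  refine (limsup_le_limsup ?_).trans h1
  filter_upwards [eventually_gt_atTop 0] with n hn
  refine le_trans ?_ (measure_union_le _ _)
  -- As `L ≤ 1`, its integral is at most the measure of any event that almost surely contains `{L ≠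
  -- 0}`; this form needs no measurability of the event.
  refine (lintegral_mono_ae ?_).trans (lintegral_indicator_one_le _)
  have hdeg : ∀ᵐ ω ∂(C.sampleLaw M n), ∀ a, a ∉ N → C.covHat M w π₀ pol ω a a = 0 ∧
      SafePolicy.CrossFit.target M w π₀ pol a - C.diffHat M w π₀ ω (pol a.1) a.2 = 0 := by
    rw [ae_all_iff]
    intro a
    by_cases ha : a ∈ N
    · simp [ha]
    · have h0 : SafePolicy.CrossFit.trueCov M w π₀ pol a a = 0 := by simpa [hNdef] using ha
      filter_upwards [C.ae_degenerate M w π₀ pol hc.1 hpos hv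
        (hvar.mono fun x hx k => hx k a.2 a.2.2) h0 n] with ω hω _ using hω
  filter_upwards [hdeg] with ω hω
  by_cases h0 : L n ω = 0
  · rw [h0]
    exact zero_le
  refine (hL1 n ω).trans (le_of_eq ?_)
  rw [Set.indicator_of_mem, Pi.one_apply]
  have hpsd := C.posSemidef_covHat M w π₀ pol ω
  rcases hL0 n ω hn h0 with ⟨a, ha, hlt⟩ | ⟨a, ha, hle⟩
  · refine Or.inr ⟨a, ?_, (Real.sqrt_eq_zero hpsd.diag_nonneg).1 ha⟩
    by_contra haN
    exact hlt.ne (hω a haN).2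
  · refine Or.inl ⟨a, ?_, hpsd, (measure_mono ?_).trans hle⟩
    · by_contra haN
      exact ha (by rw [(hω a haN).1, Real.sqrt_zero])
    -- The simulated minimum runs over all coordinates, including those contributing `0`. It lies
    -- below the minimum over `N`, so the tail probability for `N` is the smaller one.
    · rintro ρ ⟨b, -, hb⟩
      exact (ciInf_le (f := fun b => ρ b / √(C.covHat M w π₀ pol ω b b))
        (Set.finite_range _).bddBelow b).trans hb
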